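/- Let $n\ge 2$, let $N\subset\mathbb{R}^p$ be a compact $C^\infty$ embedded submanifold (with the induced Riemannian metric), and let $\varphi\in W^{1,2}_{\mathrm{loc}}(\mathbb{R}^n;N)$, that is, $\varphi\in W^{1,2}_{\mathrm{loc}}(\mathbb{R}^n;\mathbb{R}^p)$ and $\varphi(x)\in N$ for a.e. $x$. Assume that $\varphi$ is energy minimizing: for every ball $B_\rho(y)\subset\mathbb{R}^n$ one has $\int_{B_\rho(y)}|D\varphi|^2\le\int_{B_\rho(y)}|Dw|^2$ for every $w\in W^{1,2}(B_\rho(y);N)$ with $w=\varphi$ a.e. in a neighborhood of $\partial B_\rho(y)$, where $|Du|^2=\sum_{i=1}^n\sum_{j=1}^p(D_iu^j)^2$. Assume also that $\varphi$ is homogeneous of degree zero: for every $\lambda>0$, $\varphi(\lambda x)=\varphi(x)$ for a.e. $x\in\mathbb{R}^n$. Then the limit $$\Theta_\varphi(y)=\lim_{\rho\downarrow 0}\rho^{2-n}\int_{B_\rho(y)}|D\varphi|^2$$ exists in $\mathbb{R}$ for every $y\in\mathbb{R}^n$, the set $S(\varphi)=\{y\in\mathbb{R}^n:\Theta_\varphi(y)=\Theta_\varphi(0)\}$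 is a linear subspace of $\mathbb{R}^n$, and $$\dim S(\varphi)=n\iff S(\varphi)=\mathbb{R}^n\iff\varphi\text{ is constant almost everywhere.}$$ -/

import Mathlib

open MeasureTheory Filter Topology Set
open scoped ContDiff Manifold

noncomputable section

namespace EnergyMin

/-- `G` is an `L²` gradient of the map `u` on the open set `Ω ⊆ ℝⁿ`: each `G i` lies in
`L²(Ω; ℝᵖ)` and is the weak partial derivative `Dᵢ u`, i.e. `∫_Ω ψ Dᵢu = - ∫_Ω (Dᵢψ) u` for all
`ψ ∈ C_c^∞(Ω)`. (The integrals are vector valued, which is the same as asking this for each of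
the `p` components of `u`.) -/
def IsL2Gradient {n p : ℕ} (Ω : Set (EuclideanSpace ℝ (Fin n)))
    (u : EuclideanSpace ℝ (Fin n) → EuclideanSpace ℝ (Fin p))
    (G : Fin n → EuclideanSpace ℝ (Fin n) → EuclideanSpace ℝ (Fin p)) : Prop :=
  (∀ i, MemLp (G i) 2 (volume.restrict Ω)) ∧
  ∀ ψ : EuclideanSpace ℝ (Fin n) → ℝ, ContDiff ℝ ∞ ψ → HasCompactSupport ψ → tsupport ψ ⊆ Ω →
    ∀ i, ∫ x in Ω, ψ x • G i x = - ∫ x in Ω, fderiv ℝ ψ x (EuclideanSpace.single i 1) • u x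

/-- The Sobolev space `W^{1,2}(Ω; ℝᵖ)`. -/
def MemW12 {n p : ℕ} (Ω : Set (EuclideanSpace ℝ (Fin n)))
    (u : EuclideanSpace ℝ (Fin n) → EuclideanSpace ℝ (Fin p)) : Prop :=
  MemLp u 2 (volume.restrict Ω) ∧ ∃ G, IsL2Gradient Ω u G

/-- The set `W^{1,2}(Ω; N)` of those `u ∈ W^{1,2}(Ω; ℝᵖ)` with `u(x) ∈ N` for a.e. `x ∈ Ω`. -/
def MemW12Into {n p : ℕ} (Ω : Set (EuclideanSpace ℝ (Fin n)))
    (N : Set (EuclideanSpace ℝ (Fin p)))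
    (u : EuclideanSpace ℝ (Fin n) → EuclideanSpace ℝ (Fin p)) : Prop :=
  MemW12 Ω u ∧ ∀ᵐ x ∂(volume.restrict Ω), u x ∈ N

/-- The set `W^{1,2}_loc(Ω; N)`: `u ∈ W^{1,2}(V; ℝᵖ)` for every open `V` whose closure is a
compact subset of `Ω`, and `u(x) ∈ N` for a.e. `x ∈ Ω`. -/
def MemW12LocInto {n p : ℕ} (Ω : Set (EuclideanSpace ℝ (Fin n)))
    (N : Set (EuclideanSpace ℝ (Fin p)))
    (u : EuclideanSpace ℝ (Fin n) → EuclideanSpace ℝ (Fin p)) : Prop :=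
  (∀ V, IsOpen V → IsCompact (closure V) → closure V ⊆ Ω → MemW12 V u) ∧
    ∀ᵐ x ∂(volume.restrict Ω), u x ∈ N

open Classical in
/-- The weak gradient `(D₁u, …, Dₙu)` of `u` on the open set `Ω`. It is unique up to equality
a.e. on `Ω`; the value `0` is used when `u` has no `L²` gradient on `Ω`. -/
def weakGradient {n p : ℕ} (Ω : Set (EuclideanSpace ℝ (Fin n)))
    (u : EuclideanSpace ℝ (Fin n) → EuclideanSpace ℝ (Fin p)) :
    Fin n → EuclideanSpace ℝ (Fin n) → EuclideanSpace ℝ (Fin p) :=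
  if h : ∃ G, IsL2Gradient Ω u G then h.choose else 0

/-- The energy `∫_Ω |Du|²`, where `|Du|² = ∑ᵢ ∑ⱼ (Dᵢ uʲ)²`. -/
def energy {n p : ℕ} (Ω : Set (EuclideanSpace ℝ (Fin n)))
    (u : EuclideanSpace ℝ (Fin n) → EuclideanSpace ℝ (Fin p)) : ℝ :=
  ∫ x in Ω, ∑ i, ∑ j, (weakGradient Ω u i x j) ^ 2

/-- `u ∈ W^{1,2}_loc(Ω; N)` is energy minimizing: on each ball `B` with closure in `Ω`, its energy
is at most that of any `w ∈ W^{1,2}(B; N)` which agrees with `u` (a.e.) near `∂B`. -/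
def IsEnergyMinimizing {n p : ℕ} (Ω : Set (EuclideanSpace ℝ (Fin n)))
    (N : Set (EuclideanSpace ℝ (Fin p)))
    (u : EuclideanSpace ℝ (Fin n) → EuclideanSpace ℝ (Fin p)) : Prop :=
  MemW12LocInto Ω N u ∧
  ∀ (y : EuclideanSpace ℝ (Fin n)) (ρ : ℝ), 0 < ρ → Metric.closedBall y ρ ⊆ Ω →
    ∀ w : EuclideanSpace ℝ (Fin n) → EuclideanSpace ℝ (Fin p),
      MemW12Into (Metric.ball y ρ) N w →
      (∃ U, IsOpen U ∧ Metric.sphere y ρ ⊆ U ∧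
        ∀ᵐ x ∂(volume.restrict (U ∩ Metric.ball y ρ)), w x = u x) →
      energy (Metric.ball y ρ) u ≤ energy (Metric.ball y ρ) w

/-- A homogeneous degree zero minimizer: an energy minimizing map `φ : ℝⁿ → N` with
`φ(λ x) = φ(x)` for all `λ > 0` (as elements of `W^{1,2}_loc`, i.e. for a.e. `x`). -/
def IsHomogeneousMinimizer {n p : ℕ} (N : Set (EuclideanSpace ℝ (Fin p)))
    (φ : EuclideanSpace ℝ (Fin n) → EuclideanSpace ℝ (Fin p)) : Prop :=
  IsEnergyMinimizing univ N φ ∧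
  ∀ c : ℝ, 0 < c → ∀ᵐ x : EuclideanSpace ℝ (Fin n), φ (c • x) = φ x

/-- The scaled energy `ρ^{2-n} ∫_{B_ρ(y)} |Du|²`. -/
def scaledEnergy {n p : ℕ} (u : EuclideanSpace ℝ (Fin n) → EuclideanSpace ℝ (Fin p))
    (y : EuclideanSpace ℝ (Fin n)) (ρ : ℝ) : ℝ :=
  ρ ^ (2 - (n : ℤ)) * energy (Metric.ball y ρ) u

/-- The density `Θ_u(y) = lim_{ρ ↓ 0} ρ^{2-n} ∫_{B_ρ(y)} |Du|²`. -/
def density {n p : ℕ} (u : EuclideanSpace ℝ (Fin n) → EuclideanSpace ℝ (Fin p))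
    (y : EuclideanSpace ℝ (Fin n)) : ℝ :=
  limUnder (𝓝[>] (0 : ℝ)) (scaledEnergy u y)

/-- The set `S(φ) = {y ∈ ℝⁿ : Θ_φ(y) = Θ_φ(0)}`. -/
def maxDensitySet {n p : ℕ} (φ : EuclideanSpace ℝ (Fin n) → EuclideanSpace ℝ (Fin p)) :
    Set (EuclideanSpace ℝ (Fin n)) :=
  {y | density φ y = density φ 0}

end EnergyMin

end

noncomputable section

namespace EnergyMin

/-! Composing `φ` on the right with the inverse of a small perturbation `id + tζ` of the identity
keeps values in `N` and changes nothing off the support of `ζ`, so it gives an admissible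
competitor. Changing variables and expanding to first order in `t`, for both signs of `t`, yields
the stationarity identity `integral_firstVar_eq_zero`.

For radial `ζ` centred at `y` this becomes the monotonicity formula `gradEnergy_sub_gradEnergy`:
between the radii `σ < ρ` the scaled energy about `y` grows by twice the integral of `|x - y|^{-n}
|(x - y)·Dφ|²` over the annulus. A nonnegative monotone function has a limit at `0`, so the density
exists everywhere.

Homogeneity makes the scaled energy about `0` a constant `T = Θ(0)`. Comparing large balls centred
at `y` and at `0`, the scaled energy about any `y` tends to `T` as `ρ → ∞`. Hence `Θ(y) ≤ T`, and
equality forces the scaled energy about `y` to be constant, that is, `(x - y)·Dφ(x) = 0` for a.e.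
`x` (`tendsto_gradEnergy_iff`). For `y = 0` this reads `x·Dφ = 0`; subtracting, `y ∈ S(φ)` if and
only if `y·Dφ = 0` a.e., which is linear in `y` (`invariantSubmodule`). The subspace is everything
exactly when `Dφ = 0` a.e., that is, when `φ` is a.e. constant (`invariantSubmodule_eq_top_iff`). -/

/-- Euclidean space `ℝⁿ`. -/
abbrev Eucl (n : ℕ) := EuclideanSpace ℝ (Fin n)

/-- `G` is a (measurable, locally square integrable) weak gradient of `u` on all of `ℝⁿ`. -/
structure HasWeakGradient {n p : ℕ} (u : Eucl n → Eucl p) (G : Fin n → Eucl n → Eucl p) :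
    Prop where
  measurable : ∀ i, Measurable (G i)
  memLp : ∀ i (R : ℝ), MemLp (G i) 2 (volume.restrict (Metric.ball 0 R))
  integral_eq : ∀ ψ : Eucl n → ℝ, ContDiff ℝ ∞ ψ → HasCompactSupport ψ → ∀ i,
    ∫ x, ψ x • G i x = - ∫ x, fderiv ℝ ψ x (EuclideanSpace.single i 1) • u x

/-! ### Weak gradients: uniqueness, and a global representative. -/

section basic

variable {n p : ℕ}

lemma fderiv_eq_zero_of_notMem_tsupport {F F' : Type*} [NormedAddCommGroup F] [NormedSpace ℝ F]
    [NormedAddCommGroup F'] [NormedSpace ℝ F'] {f : F → F'} {x : F}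
    (hx : x ∉ tsupport f) : fderiv ℝ f x = 0 := by
  have := support_fderiv_subset ℝ (f := f)
  by_contra h
  exact hx (this h)

lemma setIntegral_smul_eq_integral {Ω : Set (Eucl n)} {ψ : Eucl n → ℝ}
    (hψ : tsupport ψ ⊆ Ω) (g : Eucl n → Eucl p) :
    ∫ x in Ω, ψ x • g x = ∫ x, ψ x • g x := by
  apply setIntegral_eq_integral_of_forall_compl_eq_zero
  intro x hx
  rw [image_eq_zero_of_notMem_tsupport (fun h => hx (hψ h)), zero_smul]

lemma setIntegral_fderiv_smul_eq_integral {Ω : Set (Eucl n)} {ψ : Eucl n → ℝ}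
    (hψ : tsupport ψ ⊆ Ω) (g : Eucl n → Eucl p) (v : Eucl n) :
    ∫ x in Ω, fderiv ℝ ψ x v • g x = ∫ x, fderiv ℝ ψ x v • g x := by
  apply setIntegral_eq_integral_of_forall_compl_eq_zero
  intro x hx
  rw [fderiv_eq_zero_of_notMem_tsupport (fun h => hx (hψ h)), zero_apply, zero_smul]

lemma IsL2Gradient.mono {Ω Ω' : Set (Eucl n)} {u : Eucl n → Eucl p}
    {G : Fin n → Eucl n → Eucl p} (h : IsL2Gradient Ω u G) (hsub : Ω' ⊆ Ω) :
    IsL2Gradient Ω' u G := by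
  refine ⟨fun i => (h.1 i).mono_measure (Measure.restrict_mono hsub le_rfl), ?_⟩
  intro ψ h1 h2 h3 i
  rw [setIntegral_smul_eq_integral h3, setIntegral_fderiv_smul_eq_integral h3,
    ← setIntegral_smul_eq_integral (h3.trans hsub),
    ← setIntegral_fderiv_smul_eq_integral (h3.trans hsub)]
  exact h.2 ψ h1 h2 (h3.trans hsub) i

lemma _root_.MeasureTheory.MemLp.locallyIntegrableOn_of_two {Ω : Set (Eucl n)}
    {g : Eucl n → Eucl p} (h : MemLp g 2 (volume.restrict Ω)) : LocallyIntegrableOn g Ω := by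
  exact locallyIntegrableOn_of_locallyIntegrable_restrict (h.locallyIntegrable one_le_two)

/-- The difference of the two gradients integrates to zero against every test function, so the
fundamental lemma of the calculus of variations applies. -/
lemma IsL2Gradient.ae_eq {Ω : Set (Eucl n)} (hΩ : IsOpen Ω) {u v : Eucl n → Eucl p}
    {G G' : Fin n → Eucl n → Eucl p} (h : IsL2Gradient Ω u G) (h' : IsL2Gradient Ω v G')
    (huv : ∀ᵐ x ∂(volume.restrict Ω), u x = v x) (i : Fin n) :
    ∀ᵐ x ∂(volume.restrict Ω), G i x = G' i x := by
  have key : ∀ᵐ x : Eucl n, x ∈ Ω → G i x - G' i x = 0 := by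
    refine hΩ.ae_eq_zero_of_integral_contDiff_smul_eq_zero
      (MemLp.locallyIntegrableOn_of_two ((h.1 i).sub (h'.1 i))) ?_
    intro ψ h1 h2 h3
    rw [← setIntegral_smul_eq_integral h3]
    have hb : MemLp ψ 2 (volume.restrict Ω) :=
      (h1.continuous.memLp_of_hasCompactSupport h2).restrict Ω
    have int1 : ∀ g : Eucl n → Eucl p, MemLp g 2 (volume.restrict Ω) →
        Integrable (fun x => ψ x • g x) (volume.restrict Ω) := fun g hg =>
      memLp_one_iff_integrable.1 (hg.smul hb)
    simp_rw [smul_sub]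
    rw [integral_sub (int1 _ (h.1 i)) (int1 _ (h'.1 i)), h.2 ψ h1 h2 h3 i, h'.2 ψ h1 h2 h3 i]
    rw [integral_congr_ae (g := fun x => fderiv ℝ ψ x (EuclideanSpace.single i 1) • v x)]
    · simp
    · filter_upwards [huv] with x hx
      rw [hx]
  rw [ae_restrict_iff' hΩ.measurableSet]
  filter_upwards [key] with x hx hxΩ
  exact sub_eq_zero.1 (hx hxΩ)

/-- By uniqueness the arbitrary choice inside `weakGradient` is harmless; from here on energies are
computed with any convenient gradient. -/
lemma energy_eq {Ω : Set (Eucl n)} (hΩ : IsOpen Ω) {u : Eucl n → Eucl p}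
    {G : Fin n → Eucl n → Eucl p} (h : IsL2Gradient Ω u G) :
    energy Ω u = ∫ x in Ω, ∑ i, ‖G i x‖ ^ 2 := by
  have hex : ∃ G, IsL2Gradient Ω u G := ⟨G, h⟩
  have hw : IsL2Gradient Ω u (weakGradient Ω u) := by
    rw [weakGradient, dif_pos hex]
    exact hex.choose_spec
  unfold energy
  apply integral_congr_ae
  have : ∀ᵐ x ∂(volume.restrict Ω), ∀ i, weakGradient Ω u i x = G i x :=
    ae_all_iff.2 fun i => hw.ae_eq hΩ h (by simp) i
  filter_upwards [this] with x hx
  refine Finset.sum_congr rfl fun i _ => ?_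
  rw [hx i, EuclideanSpace.real_norm_sq_eq]

namespace HasWeakGradient

variable {u v : Eucl n → Eucl p} {G G' : Fin n → Eucl n → Eucl p}

lemma memLp_of_isBounded (h : HasWeakGradient u G) {Ω : Set (Eucl n)}
    (hΩ : Bornology.IsBounded Ω) (i : Fin n) : MemLp (G i) 2 (volume.restrict Ω) := by
  obtain ⟨R, hR⟩ := hΩ.subset_ball 0
  exact (h.memLp i R).mono_measure (Measure.restrict_mono hR le_rfl)

lemma isL2Gradient (h : HasWeakGradient u G) {Ω : Set (Eucl n)}
    (hΩ : Bornology.IsBounded Ω) : IsL2Gradient Ω u G := by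
  refine ⟨fun i => h.memLp_of_isBounded hΩ i, ?_⟩
  intro ψ h1 h2 h3 i
  rw [setIntegral_smul_eq_integral h3, setIntegral_fderiv_smul_eq_integral h3]
  exact h.integral_eq ψ h1 h2 i

lemma energy_ball (h : HasWeakGradient u G) (y : Eucl n) (ρ : ℝ) :
    energy (Metric.ball y ρ) u = ∫ x in Metric.ball y ρ, ∑ i, ‖G i x‖ ^ 2 :=
  energy_eq Metric.isOpen_ball (h.isL2Gradient Metric.isBounded_ball)

lemma ae_eq (h : HasWeakGradient u G) (h' : HasWeakGradient v G')
    (huv : ∀ᵐ x, u x = v x) (i : Fin n) : ∀ᵐ x, G i x = G' i x := by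
  have : ∀ k : ℕ, ∀ᵐ x : Eucl n, x ∈ Metric.ball 0 (k : ℝ) → G i x = G' i x := by
    intro k
    rw [← ae_restrict_iff' measurableSet_ball]
    exact (h.isL2Gradient Metric.isBounded_ball).ae_eq Metric.isOpen_ball
      (h'.isL2Gradient Metric.isBounded_ball) (ae_restrict_of_ae huv) i
  filter_upwards [ae_all_iff.2 this] with x hx
  obtain ⟨k, hk⟩ := exists_nat_gt ‖x‖
  exact hx k (by simpa using hk)

lemma congr (h : HasWeakGradient u G) (huv : ∀ᵐ x, u x = v x) : HasWeakGradient v G := by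
  refine ⟨h.measurable, h.memLp, ?_⟩
  intro ψ h1 h2 i
  rw [h.integral_eq ψ h1 h2 i]
  congr 1
  apply integral_congr_ae
  filter_upwards [huv] with x hx
  rw [hx]

end HasWeakGradient

lemma exists_hasWeakGradient {N : Set (Eucl p)} {u : Eucl n → Eucl p}
    (hu : MemW12LocInto univ N u) : ∃ G, HasWeakGradient u G := by
  have h1 : ∀ k : ℕ, ∃ G, IsL2Gradient (Metric.ball (0 : Eucl n) ((k : ℝ) + 1)) u G := by
    intro k
    exact (hu.1 _ Metric.isOpen_ball (by
      exact Metric.isBounded_ball.isCompact_closure) (subset_univ _)).2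
  choose Gk hGk using h1
  -- Glue the gradients on the balls of radius `k + 1`: each `x` lies in the ball with index
  -- `⌊‖x‖⌋₊`, and uniqueness makes the pieces agree a.e. on overlaps. A measurable modification is
  -- taken at the end.
  let G0 : Fin n → Eucl n → Eucl p := fun i x => Gk ⌊‖x‖⌋₊ i x
  have heq : ∀ i, ∀ k : ℕ, ∀ᵐ x ∂(volume.restrict (Metric.ball (0 : Eucl n) ((k : ℝ) + 1))),
      G0 i x = Gk k i x := by
    intro i k
    have h2 : ∀ m : ℕ, m ≤ k → ∀ᵐ x : Eucl n, x ∈ Metric.ball (0 : Eucl n) ((m : ℝ) + 1) →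
        Gk m i x = Gk k i x := by
      intro m hm
      rw [← ae_restrict_iff' measurableSet_ball]
      refine (hGk m).ae_eq Metric.isOpen_ball ((hGk k).mono (Metric.ball_subset_ball ?_))
        (by simp) i
      have : (m : ℝ) ≤ k := by exact_mod_cast hm
      linarith
    rw [ae_restrict_iff' measurableSet_ball]
    filter_upwards [ae_all_iff.2 fun m => ae_all_iff.2 (h2 m)] with x hx hxk
    have hx0 : ‖x‖ < k + 1 := by simpa using hxk
    refine hx ⌊‖x‖⌋₊ ?_ ?_
    · have : ⌊‖x‖⌋₊ < k + 1 := by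
        rw [Nat.floor_lt (norm_nonneg _)]
        exact_mod_cast hx0
      omega
    · simpa using Nat.lt_floor_add_one ‖x‖
  have hmeas : ∀ i, AEMeasurable (G0 i) := by
    intro i
    have hun : (⋃ k : ℕ, Metric.ball (0 : Eucl n) ((k : ℝ) + 1)) = univ := by
      refine eq_univ_of_forall fun x => mem_iUnion.2 ⟨⌊‖x‖⌋₊, ?_⟩
      simpa using Nat.lt_floor_add_one ‖x‖
    rw [← Measure.restrict_univ (μ := (volume : Measure (Eucl n))), ← hun, aemeasurable_iUnion_iff]
    intro k
    exact ((hGk k).1 i).1.aemeasurable.congr ((heq i k).mono fun x hx => hx.symm)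
  have heq' : ∀ i, ∀ k : ℕ, ∀ᵐ x ∂(volume.restrict (Metric.ball (0 : Eucl n) ((k : ℝ) + 1))),
      (hmeas i).mk _ x = Gk k i x := by
    intro i k
    filter_upwards [heq i k, ae_restrict_of_ae (hmeas i).ae_eq_mk] with x hx hx'
    rw [← hx', hx]
  refine ⟨fun i => (hmeas i).mk _, fun i => (hmeas i).measurable_mk, ?_, ?_⟩
  · intro i R
    obtain ⟨k, hk⟩ := exists_nat_gt R
    have : MemLp ((hmeas i).mk _) 2 (volume.restrict (Metric.ball (0 : Eucl n) ((k : ℝ) + 1))) :=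
      ((hGk k).1 i).ae_eq ((heq' i k).mono fun x hx => hx.symm)
    exact this.mono_measure (Measure.restrict_mono (Metric.ball_subset_ball (by linarith)) le_rfl)
  · intro ψ h1 h2 i
    obtain ⟨R, hR⟩ := h2.isCompact.isBounded.subset_ball (0 : Eucl n)
    obtain ⟨k, hk⟩ := exists_nat_gt R
    have hsub : tsupport ψ ⊆ Metric.ball (0 : Eucl n) ((k : ℝ) + 1) :=
      hR.trans (Metric.ball_subset_ball (by linarith))
    rw [← setIntegral_smul_eq_integral hsub, ← setIntegral_fderiv_smul_eq_integral hsub,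
      ← (hGk k).2 ψ h1 h2 hsub i]
    apply integral_congr_ae
    filter_upwards [heq' i k] with x hx
    rw [hx]

end basic

/-! ### The chain rule for weak gradients under diffeomorphisms. -/

/-- `H` is a smooth diffeomorphism of `ℝⁿ` with inverse `F`. -/
structure IsDiffeo {n : ℕ} (H F : Eucl n → Eucl n) : Prop where
  contDiff : ContDiff ℝ ∞ H
  contDiff_inv : ContDiff ℝ ∞ F
  left_inv : ∀ x, F (H x) = x
  right_inv : ∀ x, H (F x) = x

section chain

variable {n p : ℕ}

lemma det_eq_matrix_det (L : Eucl n →L[ℝ] Eucl n) :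
    L.det = (Matrix.of fun i j => L (EuclideanSpace.single j 1) i).det := by
  rw [ContinuousLinearMap.det,
    ← LinearMap.det_toMatrix (EuclideanSpace.basisFun (Fin n) ℝ).toBasis]
  congr 1

lemma contDiff_det : ContDiff ℝ ∞ (fun L : Eucl n →L[ℝ] Eucl n => L.det) := by
  simp_rw [det_eq_matrix_det, Matrix.det_apply]
  refine ContDiff.sum fun σ _ => ContDiff.const_smul _ (contDiff_prod fun i _ => ?_)
  simp only [Matrix.of_apply]
  exact (EuclideanSpace.proj (σ i) : Eucl n →L[ℝ] ℝ).contDiff.comp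
    (ContinuousLinearMap.apply ℝ (Eucl n) (EuclideanSpace.single i (1 : ℝ))).contDiff

lemma sum_coord_smul_map {W : Type*} [AddCommGroup W] [Module ℝ W] (L : Eucl n →ₗ[ℝ] W)
    (v : Eucl n) : ∑ j, v j • L (EuclideanSpace.single j 1) = L v := by
  conv_rhs => rw [← (EuclideanSpace.basisFun (Fin n) ℝ).sum_repr v, map_sum]
  simp

lemma contDiff_coord (j : Fin n) : ContDiff ℝ ∞ (fun v : Eucl n => v j) :=
  (EuclideanSpace.proj j : Eucl n →L[ℝ] ℝ).contDiff

lemma HasWeakGradient.locallyIntegrable {u : Eucl n → Eucl p} {G : Fin n → Eucl n → Eucl p}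
    (h : HasWeakGradient u G) (i : Fin n) : LocallyIntegrable (G i) := by
  intro x
  refine ⟨Metric.ball x 1, Metric.ball_mem_nhds x one_pos, ?_⟩
  have : IsFiniteMeasure (volume.restrict (Metric.ball x 1)) :=
    ⟨by rw [Measure.restrict_apply_univ]; exact measure_ball_lt_top⟩
  exact (h.memLp_of_isBounded Metric.isBounded_ball i).integrable one_le_two

lemma _root_.MeasureTheory.MemLp.continuous_smul_ball {c : Eucl n → ℝ} (hc : Continuous c)
    {g : Eucl n → Eucl p} {y : Eucl n} {ρ : ℝ}
    (hg : MemLp g 2 (volume.restrict (Metric.ball y ρ))) :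
    MemLp (fun x => c x • g x) 2 (volume.restrict (Metric.ball y ρ)) := by
  obtain ⟨C, hC⟩ := (isCompact_closedBall y ρ).exists_bound_of_continuousOn hc.continuousOn
  refine MemLp.of_le_mul (c := C) hg (hc.aestronglyMeasurable.smul hg.1) ?_
  rw [ae_restrict_iff' measurableSet_ball]
  refine ae_of_all _ fun x hx => ?_
  rw [norm_smul]
  gcongr
  exact hC x (Metric.ball_subset_closedBall hx)

lemma _root_.MeasureTheory.IntegrableOn.continuous_mul_ball {c : Eucl n → ℝ} (hc : Continuous c)
    {g : Eucl n → ℝ} {y : Eucl n} {ρ : ℝ} (hg : IntegrableOn g (Metric.ball y ρ)) :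
    IntegrableOn (fun x => c x * g x) (Metric.ball y ρ) := by
  obtain ⟨C, hC⟩ := (isCompact_closedBall y ρ).exists_bound_of_continuousOn hc.continuousOn
  refine Integrable.bdd_mul (c := C) hg hc.aestronglyMeasurable ?_
  rw [ae_restrict_iff' measurableSet_ball]
  exact ae_of_all _ fun x hx => hC x (Metric.ball_subset_closedBall hx)

namespace IsDiffeo

variable {H F : Eucl n → Eucl n} {u : Eucl n → Eucl p} {G : Fin n → Eucl n → Eucl p}

lemma injective (d : IsDiffeo H F) : Function.Injective H :=
  fun x y h => by rw [← d.left_inv x, h, d.left_inv]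

lemma surjective (d : IsDiffeo H F) : Function.Surjective H := fun x => ⟨F x, d.right_inv x⟩

lemma fderiv_inv_comp (d : IsDiffeo H F) (z : Eucl n) :
    (fderiv ℝ F (H z)).comp (fderiv ℝ H z) = ContinuousLinearMap.id ℝ (Eucl n) := by
  have h1 : F ∘ H = id := funext d.left_inv
  rw [← fderiv_comp z (d.contDiff_inv.differentiable (by simp)).differentiableAt
    (d.contDiff.differentiable (by simp)).differentiableAt, h1, fderiv_id]

lemma det_ne_zero (d : IsDiffeo H F) (z : Eucl n) : (fderiv ℝ H z).det ≠ 0 := by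
  intro h0
  have h1 := congrArg ContinuousLinearMap.det (d.fderiv_inv_comp z)
  have h2 : ((fderiv ℝ F (H z)).comp (fderiv ℝ H z)).det
      = (fderiv ℝ F (H z)).det * (fderiv ℝ H z).det := by
    simp only [ContinuousLinearMap.det, ContinuousLinearMap.toLinearMap_comp, LinearMap.det_comp]
  rw [h2, h0, mul_zero] at h1
  simp [ContinuousLinearMap.det] at h1

lemma contDiff_fderiv (d : IsDiffeo H F) : ContDiff ℝ ∞ (fderiv ℝ H) :=
  d.contDiff.fderiv_right (by simp)

lemma contDiff_fderiv_inv (d : IsDiffeo H F) : ContDiff ℝ ∞ (fderiv ℝ F) :=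
  d.contDiff_inv.fderiv_right (by simp)

/-- The determinant never vanishes, so the absolute value stays away from its kink. -/
lemma contDiff_abs_det (d : IsDiffeo H F) : ContDiff ℝ ∞ (fun z => |(fderiv ℝ H z).det|) := by
  rw [contDiff_iff_contDiffAt]
  intro z
  exact ContDiffAt.abs (contDiff_det.comp d.contDiff_fderiv).contDiffAt (d.det_ne_zero z)

lemma setIntegral_image (d : IsDiffeo H F) {W : Type*} [NormedAddCommGroup W] [NormedSpace ℝ W]
    {s : Set (Eucl n)} (hs : MeasurableSet s) (g : Eucl n → W) :
    ∫ x in H '' s, g x = ∫ z in s, |(fderiv ℝ H z).det| • g (H z) :=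
  integral_image_eq_integral_abs_det_fderiv_smul volume hs
    (fun x _ => (d.contDiff.differentiable (by simp)).differentiableAt.hasFDerivAt.hasFDerivWithinAt)
    d.injective.injOn g

lemma integrableOn_image_iff (d : IsDiffeo H F) {W : Type*} [NormedAddCommGroup W]
    [NormedSpace ℝ W] {s : Set (Eucl n)} (hs : MeasurableSet s) (g : Eucl n → W) :
    IntegrableOn g (H '' s) ↔ IntegrableOn (fun z => |(fderiv ℝ H z).det| • g (H z)) s :=
  integrableOn_image_iff_integrableOn_abs_det_fderiv_smul volume hs
    (fun x _ => (d.contDiff.differentiable (by simp)).differentiableAt.hasFDerivAt.hasFDerivWithinAt)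
    d.injective.injOn g

lemma integral_eq (d : IsDiffeo H F) {W : Type*} [NormedAddCommGroup W] [NormedSpace ℝ W]
    (g : Eucl n → W) : ∫ x, g x = ∫ z, |(fderiv ℝ H z).det| • g (H z) := by
  have := d.setIntegral_image MeasurableSet.univ g
  rwa [image_univ, d.surjective.range_eq, setIntegral_univ, setIntegral_univ] at this

/-- The `j`-th component of the pull back of the vector field `ψ eᵢ`, weighted by the Jacobian. -/
def pullField (H F : Eucl n → Eucl n) (ψ : Eucl n → ℝ) (i j : Fin n) (z : Eucl n) : ℝ :=
  |(fderiv ℝ H z).det| * (ψ (H z) * (fderiv ℝ F (H z) (EuclideanSpace.single i 1)) j)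

lemma contDiff_pullField (d : IsDiffeo H F) {ψ : Eucl n → ℝ} (hψ : ContDiff ℝ ∞ ψ)
    (i j : Fin n) : ContDiff ℝ ∞ (pullField H F ψ i j) := by
  refine d.contDiff_abs_det.mul ((hψ.comp d.contDiff).mul ?_)
  exact (contDiff_coord j).comp
    ((d.contDiff_fderiv_inv.comp d.contDiff).clm_apply contDiff_const)

lemma hasCompactSupport_pullField (d : IsDiffeo H F) {ψ : Eucl n → ℝ}
    (hψ : HasCompactSupport ψ) (i j : Fin n) : HasCompactSupport (pullField H F ψ i j) := by
  refine HasCompactSupport.intro (hψ.isCompact.image d.contDiff_inv.continuous) ?_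
  intro z hz
  have : H z ∉ tsupport ψ := fun h => hz ⟨H z, h, d.left_inv z⟩
  simp [pullField, image_eq_zero_of_notMem_tsupport this]

/-- The Piola identity, tested against smooth functions. -/
lemma sum_fderiv_pullField (d : IsDiffeo H F) {ψ : Eucl n → ℝ} (hψ : ContDiff ℝ ∞ ψ)
    (hψc : HasCompactSupport ψ) (i : Fin n) (z : Eucl n) :
    ∑ j, fderiv ℝ (pullField H F ψ i j) z (EuclideanSpace.single j 1)
      = |(fderiv ℝ H z).det| * fderiv ℝ ψ (H z) (EuclideanSpace.single i 1) := by
  have hχ := d.contDiff_pullField hψ i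
  have hχc := d.hasCompactSupport_pullField hψc i
  have c1 : ∀ j, Continuous fun z =>
      fderiv ℝ (pullField H F ψ i j) z (EuclideanSpace.single j 1) := fun j =>
    ((hχ j).continuous_fderiv (by simp)).clm_apply continuous_const
  have c2 : Continuous fun z =>
      |(fderiv ℝ H z).det| * fderiv ℝ ψ (H z) (EuclideanSpace.single i 1) :=
    d.contDiff_abs_det.continuous.mul
      (((hψ.continuous_fderiv (by simp)).comp d.contDiff.continuous).clm_apply continuous_const)
  have c3 := continuous_finsetSum Finset.univ fun j _ => c1 j
  -- The identity is proved by duality, which avoids differentiating the Jacobian: tested against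
  -- `v`, both sides become `-∫ ψ Dᵢ(v ∘ F)` after integration by parts and the change of variables
  -- `x = H z`. Continuity then upgrades a.e. to everywhere.
  suffices h : ∀ᵐ z : Eucl n, (∑ j, fderiv ℝ (pullField H F ψ i j) z (EuclideanSpace.single j 1))
      - |(fderiv ℝ H z).det| * fderiv ℝ ψ (H z) (EuclideanSpace.single i 1) = 0 by
    have h' := (Continuous.ae_eq_iff_eq volume (c3.sub c2) continuous_const).1 h
    exact sub_eq_zero.1 (congrFun h' z)
  refine ae_eq_zero_of_integral_contDiff_smul_eq_zero (c3.sub c2).locallyIntegrable ?_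
  intro v hv hvc
  have dv : ∀ x, DifferentiableAt ℝ v x := fun x => (hv.differentiable (by simp)).differentiableAt
  have dF : ∀ x, DifferentiableAt ℝ F x :=
    fun x => (d.contDiff_inv.differentiable (by simp)).differentiableAt
  have ibp : ∀ j, ∫ x, v x * fderiv ℝ (pullField H F ψ i j) x (EuclideanSpace.single j 1)
      = - ∫ x, fderiv ℝ v x (EuclideanSpace.single j 1) * pullField H F ψ i j x := by
    intro j
    refine integral_mul_fderiv_eq_neg_fderiv_mul_of_integrable ?_ ?_ ?_ (fun x _ => dv x)
      (fun x _ => ((hχ j).differentiable (by simp)).differentiableAt)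
    · exact ((((hv.continuous_fderiv (by simp)).clm_apply continuous_const).mul
        (hχ j).continuous).integrable_of_hasCompactSupport ((hχc j).mul_left))
    · exact (hv.continuous.mul (c1 j)).integrable_of_hasCompactSupport hvc.mul_right
    · exact (hv.continuous.mul (hχ j).continuous).integrable_of_hasCompactSupport hvc.mul_right
  have hvF : ContDiff ℝ ∞ (v ∘ F) := hv.comp d.contDiff_inv
  have ibp2 : ∫ x, ψ x * fderiv ℝ (v ∘ F) x (EuclideanSpace.single i 1)
      = - ∫ x, fderiv ℝ ψ x (EuclideanSpace.single i 1) * (v ∘ F) x := by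
    refine integral_mul_fderiv_eq_neg_fderiv_mul_of_integrable ?_ ?_ ?_
      (fun x _ => (hψ.differentiable (by simp)).differentiableAt)
      (fun x _ => (hvF.differentiable (by simp)).differentiableAt)
    · exact ((((hψ.continuous_fderiv (by simp)).clm_apply continuous_const).mul
        hvF.continuous).integrable_of_hasCompactSupport
          ((hψc.fderiv_apply (𝕜 := ℝ) _).mul_right))
    · exact (hψ.continuous.mul ((hvF.continuous_fderiv (by simp)).clm_apply
        continuous_const)).integrable_of_hasCompactSupport hψc.mul_right
    · exact (hψ.continuous.mul hvF.continuous).integrable_of_hasCompactSupport hψc.mul_right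
  have e1 : ∫ x, v x * ∑ j, fderiv ℝ (pullField H F ψ i j) x (EuclideanSpace.single j 1)
      = - ∫ x, ψ x * fderiv ℝ (v ∘ F) x (EuclideanSpace.single i 1) := by
    simp_rw [Finset.mul_sum]
    rw [integral_finsetSum]
    swap
    · exact fun j _ =>
        (hv.continuous.mul (c1 j)).integrable_of_hasCompactSupport hvc.mul_right
    simp_rw [ibp]
    rw [Finset.sum_neg_distrib, ← integral_finsetSum, d.integral_eq (fun x => ψ x * _)]
    swap
    · exact fun j _ => (((hv.continuous_fderiv (by simp)).clm_apply continuous_const).mul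
        (hχ j).continuous).integrable_of_hasCompactSupport ((hχc j).mul_left)
    congr 2
    funext z
    have hfd : fderiv ℝ (v ∘ F) (H z) = (fderiv ℝ v z).comp (fderiv ℝ F (H z)) := by
      rw [fderiv_comp _ (dv _) (dF _), d.left_inv]
    rw [hfd, ContinuousLinearMap.comp_apply, ← ContinuousLinearMap.coe_coe (fderiv ℝ v z),
      ← sum_coord_smul_map (fderiv ℝ v z : Eucl n →ₗ[ℝ] ℝ), smul_eq_mul, Finset.mul_sum,
      Finset.mul_sum]
    refine Finset.sum_congr rfl fun j _ => ?_
    simp only [pullField, smul_eq_mul, ContinuousLinearMap.coe_coe]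
    ring
  have e2 : ∫ x, v x * (|(fderiv ℝ H x).det| * fderiv ℝ ψ (H x) (EuclideanSpace.single i 1))
      = ∫ x, fderiv ℝ ψ x (EuclideanSpace.single i 1) * (v ∘ F) x := by
    rw [d.integral_eq (fun x => fderiv ℝ ψ x _ * (v ∘ F) x)]
    congr 1
    funext z
    simp only [Function.comp_apply, d.left_inv, smul_eq_mul]
    ring
  simp_rw [smul_eq_mul, mul_sub]
  rw [integral_sub, e1, e2, ibp2]
  · ring
  · exact (hv.continuous.mul c3).integrable_of_hasCompactSupport hvc.mul_right
  · exact (hv.continuous.mul c2).integrable_of_hasCompactSupport hvc.mul_right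

/-- The chain rule candidate for the gradient of `u ∘ F`. -/
def compGradient (F : Eucl n → Eucl n) (G : Fin n → Eucl n → Eucl p) (i : Fin n) (x : Eucl n) :
    Eucl p :=
  ∑ j, (fderiv ℝ F x (EuclideanSpace.single i 1)) j • G j (F x)

/-- The chain rule for weak gradients under smooth diffeomorphisms. -/
lemma integral_smul_compGradient (d : IsDiffeo H F) (hG : HasWeakGradient u G)
    (hu : LocallyIntegrable u) {ψ : Eucl n → ℝ} (hψ : ContDiff ℝ ∞ ψ)
    (hψc : HasCompactSupport ψ) (i : Fin n) :
    ∫ x, ψ x • compGradient F G i x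
      = - ∫ x, fderiv ℝ ψ x (EuclideanSpace.single i 1) • u (F x) := by
  have hχ := d.contDiff_pullField hψ i
  have hχc := d.hasCompactSupport_pullField hψc i
  -- After the change of variables the components of the pulled-back field serve as test functions
  -- for `G`; the divergence that appears is evaluated by `sum_fderiv_pullField`.
  have e1 : ∫ x, ψ x • compGradient F G i x = ∫ z, ∑ j, pullField H F ψ i j z • G j z := by
    rw [d.integral_eq]
    congr 1
    funext z
    simp only [compGradient, d.left_inv, Finset.smul_sum, smul_smul, pullField]
  rw [e1, integral_finsetSum _ fun j _ =>
    (hG.locallyIntegrable j).integrable_smul_left_of_hasCompactSupport (hχ j).continuous (hχc j)]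
  simp_rw [fun j => hG.integral_eq _ (hχ j) (hχc j) j]
  rw [Finset.sum_neg_distrib, ← integral_finsetSum _ fun j _ =>
    hu.integrable_smul_left_of_hasCompactSupport
      (((hχ j).continuous_fderiv (by simp)).clm_apply continuous_const)
      ((hχc j).fderiv_apply (𝕜 := ℝ) _)]
  congr 1
  rw [d.integral_eq (fun x => fderiv ℝ ψ x (EuclideanSpace.single i 1) • u (F x))]
  congr 1
  funext z
  rw [← Finset.sum_smul, d.sum_fderiv_pullField hψ hψc, d.left_inv, smul_smul]

lemma setIntegral_sq_compGradient (d : IsDiffeo H F) {Ω Ω' : Set (Eucl n)} (hΩ : MeasurableSet Ω)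
    (himg : H '' Ω = Ω') :
    ∫ x in Ω', ∑ i, ‖compGradient F G i x‖ ^ 2
      = ∫ z in Ω, |(fderiv ℝ H z).det| *
          ∑ i, ‖∑ j, (fderiv ℝ F (H z) (EuclideanSpace.single i 1)) j • G j z‖ ^ 2 := by
  conv_lhs => rw [← himg, d.setIntegral_image hΩ]
  simp only [compGradient, d.left_inv, smul_eq_mul]

lemma measurable_compGradient (d : IsDiffeo H F) (hG : ∀ i, Measurable (G i)) (i : Fin n) :
    Measurable (compGradient F G i) := by
  have hF : Measurable F := d.contDiff_inv.continuous.measurable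
  refine Finset.measurable_sum _ fun j _ => Measurable.fun_smul ?_ ((hG j).comp hF)
  exact (((contDiff_coord j).continuous).comp
    (d.contDiff_fderiv_inv.continuous.clm_apply continuous_const)).measurable

lemma memLp_compGradient (d : IsDiffeo H F) (hG : HasWeakGradient u G) {y z : Eucl n}
    {ρ r : ℝ} (himg : H '' Metric.ball z r = Metric.ball y ρ) (i : Fin n) :
    MemLp (compGradient F G i) 2 (volume.restrict (Metric.ball y ρ)) := by
  rw [memLp_two_iff_integrable_sq_norm
    (d.measurable_compGradient hG.measurable i).aestronglyMeasurable]
  change IntegrableOn (fun x => ‖compGradient F G i x‖ ^ 2) (Metric.ball y ρ)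
  rw [← himg, d.integrableOn_image_iff measurableSet_ball]
  simp only [compGradient, d.left_inv, smul_eq_mul]
  refine IntegrableOn.continuous_mul_ball d.contDiff_abs_det.continuous ?_
  refine MemLp.integrable_norm_pow (p := 2) ?_ (by simp)
  refine memLp_finsetSum _ fun j _ => MemLp.continuous_smul_ball ?_
    (hG.memLp_of_isBounded Metric.isBounded_ball j)
  exact ((contDiff_coord j).continuous).comp
    ((d.contDiff_fderiv_inv.comp d.contDiff).continuous.clm_apply continuous_const)

lemma isL2Gradient_compGradient (d : IsDiffeo H F) (hG : HasWeakGradient u G)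
    (hu : LocallyIntegrable u) {y : Eucl n} {ρ : ℝ}
    (himg : H '' Metric.ball y ρ = Metric.ball y ρ) :
    IsL2Gradient (Metric.ball y ρ) (u ∘ F) (compGradient F G) := by
  refine ⟨d.memLp_compGradient hG himg, ?_⟩
  intro ψ h1 h2 h3 i
  rw [setIntegral_smul_eq_integral h3, setIntegral_fderiv_smul_eq_integral h3]
  exact d.integral_smul_compGradient hG hu h1 h2 i

/-- The exceptional set for `P ∘ F` lies in the image under `H` of that for `P`, and differentiable
maps send null sets to null sets. -/
lemma ae_comp_inv (d : IsDiffeo H F) {P : Eucl n → Prop} (hP : ∀ᵐ x, P x) :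
    ∀ᵐ x, P (F x) := by
  rw [ae_iff] at hP ⊢
  refine measure_mono_null ?_ (addHaar_image_eq_zero_of_differentiableOn_of_addHaar_eq_zero volume
    (d.contDiff.differentiable (by simp)).differentiableOn hP)
  intro x hx
  exact ⟨F x, hx, d.right_inv x⟩

end IsDiffeo

end chain

/-! ### First-order expansion of the transformed energy density. -/

section expansion

variable {n p : ℕ}

/-- The trace of an endomorphism of `ℝⁿ`, as a continuous linear functional. -/
def traceL (n : ℕ) : (Eucl n →L[ℝ] Eucl n) →L[ℝ] ℝ :=
  ∑ i, (EuclideanSpace.proj i : Eucl n →L[ℝ] ℝ).comp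
    (ContinuousLinearMap.apply ℝ (Eucl n) (EuclideanSpace.single i (1 : ℝ)))

/-- The matrix entry `(B eᵢ)ⱼ`, as a continuous linear functional of `B`. -/
def entryL (i j : Fin n) : (Eucl n →L[ℝ] Eucl n) →L[ℝ] ℝ :=
  (EuclideanSpace.proj j : Eucl n →L[ℝ] ℝ).comp
    (ContinuousLinearMap.apply ℝ (Eucl n) (EuclideanSpace.single i (1 : ℝ)))

@[simp] lemma entryL_apply (i j : Fin n) (B : Eucl n →L[ℝ] Eucl n) :
    entryL i j B = B (EuclideanSpace.single i 1) j := rfl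

@[simp] lemma traceL_apply (B : Eucl n →L[ℝ] Eucl n) :
    traceL n B = ∑ i, B (EuclideanSpace.single i 1) i := by
  simp [traceL]

lemma _root_.HasFDerivAt.hasDerivAt_smul_zero {W : Type*} [NormedAddCommGroup W] [NormedSpace ℝ W]
    {f : W → ℝ} {f' : W →L[ℝ] ℝ} (hf : HasFDerivAt f f' 0) (B : W) :
    HasDerivAt (fun t : ℝ => f (t • B)) (f' B) 0 := by
  have h1 : HasDerivAt (fun t : ℝ => t • B) B 0 := by
    simpa using (hasDerivAt_id (0 : ℝ)).smul_const B
  have h' : HasFDerivAt f f' ((0 : ℝ) • B) := by rwa [zero_smul]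
  exact h'.comp_hasDerivAt (0 : ℝ) h1

lemma hasFDerivAt_ringInverse_one_add {R : Type*} [NormedRing R] [NormedAlgebra ℝ R]
    [CompleteSpace R] (L : R →L[ℝ] ℝ) :
    HasFDerivAt (fun B : R => L (Ring.inverse (1 + B))) (-L) 0 := by
  have h1 : HasFDerivAt (fun B : R => 1 + B) (ContinuousLinearMap.id ℝ _) 0 :=
    (hasFDerivAt_id _).const_add _
  have h2 := hasFDerivAt_ringInverse (𝕜 := ℝ) (1 : Rˣ)
  have h3 : HasFDerivAt (Ring.inverse : R → R)
      (-(ContinuousLinearMap.mulLeftRight ℝ R) ((1 : Rˣ)⁻¹ : Rˣ) ((1 : Rˣ)⁻¹ : Rˣ))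
      (1 + (0 : R)) := by simpa using h2
  have h4 := L.hasFDerivAt.comp (0 : R) (h3.comp _ h1)
  refine h4.congr_fderiv (ContinuousLinearMap.ext fun B => ?_)
  simp

/-- Differentiability is known from smoothness of the determinant, so the derivative need only be
identified along lines, where `det (1 + tA) = 1 + t tr A + O(t²)`. -/
lemma hasFDerivAt_det_one_add :
    HasFDerivAt (fun B : Eucl n →L[ℝ] Eucl n => (1 + B).det) (traceL n) 0 := by
  have hd : DifferentiableAt ℝ (fun B : Eucl n →L[ℝ] Eucl n => (1 + B).det) 0 :=
    ((contDiff_det (n := n)).comp (contDiff_const.add contDiff_id)).differentiable (by simp) _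
  have h := hd.hasFDerivAt
  refine h.congr_fderiv (ContinuousLinearMap.ext fun B => ?_)
  have h2 : HasDerivAt (fun t : ℝ => (1 + t • B).det)
      (fderiv ℝ (fun B : Eucl n →L[ℝ] Eucl n => (1 + B).det) 0 B) 0 :=
    h.hasDerivAt_smul_zero B
  let A : Matrix (Fin n) (Fin n) ℝ := Matrix.of fun i j => B (EuclideanSpace.single j 1) i
  obtain ⟨q, hq⟩ : ∃ q : Polynomial ℝ, ∀ t : ℝ,
      (1 + t • B).det = 1 + A.trace * t + q.eval t * t ^ 2 := by
    refine ⟨_, fun t => Eq.trans ?_ (Matrix.det_one_add_smul t A)⟩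
    rw [det_eq_matrix_det]
    congr 1
    ext i j
    simp [A, Matrix.one_apply]
  simp_rw [hq] at h2
  have h4 : HasDerivAt (fun t : ℝ => 1 + A.trace * t + q.eval t * t ^ 2) A.trace 0 := by
    have := (((hasDerivAt_id (0 : ℝ)).const_mul A.trace).const_add 1).add
      ((q.hasDerivAt 0).mul ((hasDerivAt_id (0 : ℝ)).pow 2))
    convert! this using 1
    simp
  rw [h2.unique h4, traceL_apply]
  simp [A, Matrix.trace, Matrix.diag]

lemma hasFDerivAt_entry_inverse (i j : Fin n) :
    HasFDerivAt (fun B : Eucl n →L[ℝ] Eucl n =>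
      (Ring.inverse (1 + B)) (EuclideanSpace.single i 1) j) (-entryL i j) 0 :=
  hasFDerivAt_ringInverse_one_add (entryL i j)

/-- The weights in the energy density of `u ∘ (id + B)⁻¹` after the change of variables. -/
def energyWeight (B : Eucl n →L[ℝ] Eucl n) (j k : Fin n) : ℝ :=
  (1 + B).det * ∑ i, (Ring.inverse (1 + B)) (EuclideanSpace.single i 1) j *
    (Ring.inverse (1 + B)) (EuclideanSpace.single i 1) k

/-- The derivative of `energyWeight` at `0`. -/
def energyWeightDeriv (j k : Fin n) : (Eucl n →L[ℝ] Eucl n) →L[ℝ] ℝ :=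
  (if j = k then 1 else 0 : ℝ) • traceL n - entryL j k - entryL k j

lemma energyWeight_zero (j k : Fin n) :
    energyWeight (0 : Eucl n →L[ℝ] Eucl n) j k = if j = k then 1 else 0 := by
  have h : (1 : Eucl n →L[ℝ] Eucl n).det = 1 := by
    simp [ContinuousLinearMap.det]
  simp [energyWeight, h]

lemma hasFDerivAt_energyWeight (j k : Fin n) :
    HasFDerivAt (fun B : Eucl n →L[ℝ] Eucl n => energyWeight B j k)
      (energyWeightDeriv j k) 0 := by
  have h := (hasFDerivAt_det_one_add (n := n)).mul (HasFDerivAt.fun_sum (u := Finset.univ)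
    fun i _ => (hasFDerivAt_entry_inverse (n := n) i j).mul (hasFDerivAt_entry_inverse i k))
  refine h.congr_fderiv (ContinuousLinearMap.ext fun B => ?_)
  have hdet : (1 : Eucl n →L[ℝ] Eucl n).det = 1 := by
    simp [ContinuousLinearMap.det]
  simp [energyWeightDeriv, hdet, Finset.sum_add_distrib]
  ring

/-- Separates the variables: the density is quadratic in `g` with coefficients depending only on
`B`, so only finitely many scalar functions of `B` need expanding. -/
lemma det_mul_sum_eq (B : Eucl n →L[ℝ] Eucl n) (g : Fin n → Eucl p) :
    (1 + B).det * ∑ i, ‖∑ j, (Ring.inverse (1 + B)) (EuclideanSpace.single i 1) j • g j‖ ^ 2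
      = ∑ j, ∑ k, energyWeight B j k * inner ℝ (g j) (g k) := by
  simp_rw [← real_inner_self_eq_norm_sq, sum_inner, inner_sum, inner_smul_left, inner_smul_right,
    energyWeight]
  rw [Finset.sum_comm, Finset.mul_sum]
  refine Finset.sum_congr rfl fun j _ => ?_
  rw [Finset.sum_comm, Finset.mul_sum]
  refine Finset.sum_congr rfl fun k _ => ?_
  rw [mul_assoc, Finset.sum_mul]
  congr 1
  refine Finset.sum_congr rfl fun i _ => ?_
  simp
  ring

/-- The integrand of the first variation of the energy. -/
def firstVar (B : Eucl n →L[ℝ] Eucl n) (g : Fin n → Eucl p) : ℝ :=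
  (∑ i, B (EuclideanSpace.single i 1) i) * ∑ i, ‖g i‖ ^ 2
    - 2 * ∑ i, ∑ j, B (EuclideanSpace.single i 1) j * inner ℝ (g i) (g j)

lemma sum_energyWeightDeriv (B : Eucl n →L[ℝ] Eucl n) (g : Fin n → Eucl p) :
    ∑ j, ∑ k, energyWeightDeriv j k B * inner ℝ (g j) (g k) = firstVar B g := by
  have h1 : ∀ j k, energyWeightDeriv j k B * inner ℝ (g j) (g k)
      = (if j = k then (∑ i, B (EuclideanSpace.single i 1) i) * inner ℝ (g j) (g k) else 0)
        - B (EuclideanSpace.single j 1) k * inner ℝ (g j) (g k)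
        - B (EuclideanSpace.single k 1) j * inner ℝ (g k) (g j) := by
    intro j k
    rw [real_inner_comm (g j) (g k)]
    by_cases h : j = k <;> simp [energyWeightDeriv, h] <;> ring
  simp_rw [h1, Finset.sum_sub_distrib]
  rw [Finset.sum_comm (f := fun j k => B (EuclideanSpace.single k 1) j * inner ℝ (g k) (g j))]
  simp only [Finset.sum_ite_eq, Finset.mem_univ, if_true, real_inner_self_eq_norm_sq, firstVar,
    Finset.mul_sum]
  simp only [← Finset.mul_sum]
  ring

lemma abs_inner_le_sum (g : Fin n → Eucl p) (j k : Fin n) :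
    |inner ℝ (g j) (g k)| ≤ ∑ i, ‖g i‖ ^ 2 := by
  have h1 : ∀ j, ‖g j‖ ^ 2 ≤ ∑ i, ‖g i‖ ^ 2 := fun j =>
    Finset.single_le_sum (f := fun i => ‖g i‖ ^ 2) (fun i _ => by positivity) (Finset.mem_univ j)
  have h2 := abs_real_inner_le_norm (g j) (g k)
  nlinarith [h1 j, h1 k, sq_nonneg (‖g j‖ - ‖g k‖)]

/-- The point is that `δ` is independent of `g`, so the estimate can be integrated over `x` with `g`
the unbounded gradient at `x`. Each of the `n²` coefficients is expanded with error `ε' ‖B‖`, where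
`n² ε' ≤ ε`. -/
lemma exists_energy_expansion (n : ℕ) {ε : ℝ} (hε : 0 < ε) :
    ∃ δ > 0, ∀ B : Eucl n →L[ℝ] Eucl n, ‖B‖ < δ → 0 < (1 + B).det ∧
      ∀ {p : ℕ} (g : Fin n → Eucl p),
        (1 + B).det * ∑ i, ‖∑ j, (Ring.inverse (1 + B)) (EuclideanSpace.single i 1) j • g j‖ ^ 2
          ≤ ∑ i, ‖g i‖ ^ 2 + firstVar B g + ε * ‖B‖ * ∑ i, ‖g i‖ ^ 2 := by
  obtain ⟨ε', hε', hεn⟩ : ∃ ε' > 0, (n : ℝ) * n * ε' ≤ ε := by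
    refine ⟨ε / ((n : ℝ) * n + 1), by positivity, ?_⟩
    rw [mul_div_assoc', div_le_iff₀ (by positivity)]
    nlinarith
  have h1 : ∀ j k : Fin n, ∀ᶠ B in 𝓝 (0 : Eucl n →L[ℝ] Eucl n),
      |energyWeight B j k - (if j = k then 1 else 0) - energyWeightDeriv j k B| ≤ ε' * ‖B‖ := by
    intro j k
    have := ((hasFDerivAt_energyWeight (n := n) j k).isLittleO).bound hε'
    simpa [energyWeight_zero] using this
  have h2 : ∀ᶠ B in 𝓝 (0 : Eucl n →L[ℝ] Eucl n), 0 < (1 + B).det := by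
    refine (hasFDerivAt_det_one_add (n := n)).continuousAt.eventually_const_lt ?_
    simp [ContinuousLinearMap.det]
  have h3 := h2.and (eventually_all.2 fun j => eventually_all.2 fun k => h1 j k)
  obtain ⟨δ, hδ, hB⟩ := Metric.eventually_nhds_iff.1 h3
  refine ⟨δ, hδ, fun B hBδ => ?_⟩
  obtain ⟨hdet, hw⟩ := hB (y := B) (by simpa using hBδ)
  refine ⟨hdet, fun {p} g => ?_⟩
  rw [det_mul_sum_eq, ← sum_energyWeightDeriv]
  have h4 : ∑ i, ‖g i‖ ^ 2
      = ∑ j, ∑ k, (if j = k then 1 else 0 : ℝ) * inner ℝ (g j) (g k) := by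
    simp
  have hS : 0 ≤ ∑ i, ‖g i‖ ^ 2 := Finset.sum_nonneg fun i _ => by positivity
  have h5 : ∑ j, ∑ k, energyWeight B j k * inner ℝ (g j) (g k)
      - ∑ j, ∑ k, (if j = k then 1 else 0 : ℝ) * inner ℝ (g j) (g k)
      - ∑ j, ∑ k, energyWeightDeriv j k B * inner ℝ (g j) (g k)
      ≤ ∑ j : Fin n, ∑ k : Fin n, ε' * ‖B‖ * ∑ i, ‖g i‖ ^ 2 := by
    simp_rw [← Finset.sum_sub_distrib, ← sub_mul]
    refine Finset.sum_le_sum fun j _ => Finset.sum_le_sum fun k _ => ?_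
    refine (le_abs_self _).trans ?_
    rw [abs_mul]
    exact mul_le_mul (hw j k) (abs_inner_le_sum g j k) (abs_nonneg _) (by positivity)
  have h6 : ∑ j : Fin n, ∑ k : Fin n, ε' * ‖B‖ * ∑ i, ‖g i‖ ^ 2
      ≤ ε * ‖B‖ * ∑ i, ‖g i‖ ^ 2 := by
    simp only [Finset.sum_const, Finset.card_univ, Fintype.card_fin, nsmul_eq_mul]
    have : 0 ≤ ‖B‖ * ∑ i, ‖g i‖ ^ 2 := by positivity
    nlinarith
  linarith

end expansion

lemma ringInverse_eq_of_mul_eq_one {R : Type*} [Ring R] {a b : R} (h : a * b = 1)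
    (h' : b * a = 1) : Ring.inverse a = b :=
  Ring.inverse_unit (⟨a, b, h, h'⟩ : Rˣ)

/-- A small perturbation of the identity is a smooth diffeomorphism. -/
lemma exists_contDiff_inverse_id_add {V : Type*} [NormedAddCommGroup V] [NormedSpace ℝ V]
    [CompleteSpace V] {ξ : V → V} (hξ : ContDiff ℝ ∞ ξ) {c : NNReal} (hc : c < 1)
    (hlip : LipschitzWith c ξ) :
    ∃ F : V → V, ContDiff ℝ ∞ F ∧ (∀ x, F (x + ξ x) = x) ∧ ∀ x, F x + ξ (F x) = x := by
  -- The map is within Lipschitz distance `c < 1` of the identity, hence a homeomorphism. Its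
  -- derivative `1 + Dξ` is invertible by the Neumann series, which makes the inverse smooth.
  have happ : ApproximatesLinearOn (fun x => x + ξ x)
      ((ContinuousLinearEquiv.refl ℝ V : V ≃L[ℝ] V) : V →L[ℝ] V) univ c := by
    intro x _ y _
    have := hlip.dist_le_mul x y
    rw [dist_eq_norm, dist_eq_norm] at this
    simpa [add_sub_add_comm] using this
  have hc' : Subsingleton V ∨
      c < ‖((ContinuousLinearEquiv.refl ℝ V).symm : V →L[ℝ] V)‖₊⁻¹ := by
    rcases subsingleton_or_nontrivial V with h | h
    · exact Or.inl h
    · right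
      have : ‖((ContinuousLinearEquiv.refl ℝ V).symm : V →L[ℝ] V)‖₊ = 1 := by
        ext
        exact ContinuousLinearMap.norm_id
      rw [this, inv_one]
      exact hc
  let e : V ≃ₜ V := happ.toHomeomorph _ hc'
  have he : ∀ x, e x = x + ξ x := fun x => rfl
  have hlt : ∀ x, ‖-fderiv ℝ ξ x‖ < 1 := fun x => by
    rw [norm_neg]
    exact (norm_fderiv_le_of_lipschitz ℝ hlip).trans_lt (by exact_mod_cast hc)
  let f' : V → V ≃L[ℝ] V := fun x =>
    ContinuousLinearEquiv.unitsEquiv ℝ V (Units.oneSub (-fderiv ℝ ξ x) (hlt x))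
  have hf' : ∀ x, HasFDerivAt e (f' x : V →L[ℝ] V) x := by
    intro x
    have h1 : HasFDerivAt (fun x => x + ξ x) (ContinuousLinearMap.id ℝ V + fderiv ℝ ξ x) x :=
      (hasFDerivAt_id x).add (hξ.differentiable (by simp)).differentiableAt.hasFDerivAt
    refine h1.congr_fderiv (ContinuousLinearMap.ext fun v => ?_)
    simp [f']
  refine ⟨e.symm, e.contDiff_symm hf' (contDiff_id.add hξ), fun x => ?_, fun x => ?_⟩
  · rw [← he, e.symm_apply_apply]
  · rw [← he, e.apply_symm_apply]

/-! ### Inner variations and stationarity. -/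

section variation

variable {n p : ℕ} {u φ : Eucl n → Eucl p} {G : Fin n → Eucl n → Eucl p}

lemma IsDiffeo.fderiv_inv_eq {H F : Eucl n → Eucl n} (d : IsDiffeo H F) (z : Eucl n) :
    fderiv ℝ F (H z) = Ring.inverse (fderiv ℝ H z) := by
  have h1 := d.fderiv_inv_comp z
  have h2 : (fderiv ℝ H z).comp (fderiv ℝ F (H z)) = ContinuousLinearMap.id ℝ (Eucl n) := by
    have := IsDiffeo.fderiv_inv_comp ⟨d.contDiff_inv, d.contDiff, d.right_inv, d.left_inv⟩ (H z)
    rwa [d.left_inv] at this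
  exact (ringInverse_eq_of_mul_eq_one h2 h1).symm

/-- The map fixes every point outside the ball, so by injectivity no inner point can leave it and by
surjectivity every inner point is hit from inside. -/
lemma IsDiffeo.image_ball {ζ F : Eucl n → Eucl n} {t : ℝ}
    (d : IsDiffeo (fun x => x + t • ζ x) F) {R : ℝ} (hR : tsupport ζ ⊆ Metric.ball 0 R) :
    (fun x => x + t • ζ x) '' Metric.ball 0 R = Metric.ball 0 R := by
  have hfix : ∀ x, x ∉ Metric.ball (0 : Eucl n) R → x + t • ζ x = x := fun x hx => by
    rw [image_eq_zero_of_notMem_tsupport (fun h => hx (hR h))]; simp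
  apply Subset.antisymm
  · rintro _ ⟨x, hx, rfl⟩
    by_contra hcon
    have h1 := hfix _ hcon
    exact hcon (by rwa [d.injective h1])
  · intro x hx
    obtain ⟨z, hz⟩ := d.surjective x
    refine ⟨z, ?_, hz⟩
    by_contra hcon
    have h1 := hfix z hcon
    have hz' : z + t • ζ z = x := hz
    exact hcon (by rwa [← h1, hz'])

lemma IsEnergyMinimizing.locallyIntegrable {N : Set (Eucl p)}
    (h : IsEnergyMinimizing univ N φ) : LocallyIntegrable φ := by
  intro x
  refine ⟨Metric.ball x 1, Metric.ball_mem_nhds x one_pos, ?_⟩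
  have : IsFiniteMeasure (volume.restrict (Metric.ball x 1)) :=
    ⟨by rw [Measure.restrict_apply_univ]; exact measure_ball_lt_top⟩
  exact (h.1.1 _ Metric.isOpen_ball Metric.isBounded_ball.isCompact_closure
    (subset_univ _)).1.integrable one_le_two

lemma HasWeakGradient.integrableOn_sum_sq (hG : HasWeakGradient u G) (y : Eucl n) (ρ : ℝ) :
    IntegrableOn (fun x => ∑ i, ‖G i x‖ ^ 2) (Metric.ball y ρ) :=
  integrable_finsetSum _ fun i _ =>
    (hG.memLp_of_isBounded Metric.isBounded_ball i).integrable_norm_pow (p := 2) (by simp)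

lemma HasWeakGradient.integrableOn_firstVar (hG : HasWeakGradient u G)
    {A : Eucl n → Eucl n →L[ℝ] Eucl n} (hA : Continuous A) (y : Eucl n) (ρ : ℝ) :
    IntegrableOn (fun x => firstVar (A x) (fun i => G i x)) (Metric.ball y ρ) := by
  have hc : ∀ i j, Continuous fun x => A x (EuclideanSpace.single i 1) j := fun i j =>
    (contDiff_coord j).continuous.comp (hA.clm_apply continuous_const)
  have hi : ∀ i j, IntegrableOn (fun x => (inner ℝ (G i x) (G j x) : ℝ)) (Metric.ball y ρ) := by
    intro i j
    refine Integrable.mono' (hG.integrableOn_sum_sq y ρ)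
      ((hG.measurable i).inner (hG.measurable j)).aestronglyMeasurable (ae_of_all _ fun x => ?_)
    exact abs_inner_le_sum (fun i => G i x) i j
  refine Integrable.sub ?_ (Integrable.const_mul ?_ 2)
  · exact IntegrableOn.continuous_mul_ball (continuous_finsetSum _ fun i _ => hc i i)
      (hG.integrableOn_sum_sq y ρ)
  · exact integrable_finsetSum _ fun i _ => integrable_finsetSum _ fun j _ =>
      IntegrableOn.continuous_mul_ball (hc i j) (hi i j)

lemma firstVar_smul (t : ℝ) (B : Eucl n →L[ℝ] Eucl n) (g : Fin n → Eucl p) :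
    firstVar (t • B) g = t * firstVar B g := by
  simp only [firstVar, smul_apply, PiLp.smul_apply, smul_eq_mul, mul_assoc,
    ← Finset.mul_sum]
  ring

/-- This is minimality tested on the competitor `φ ∘ F`. -/
lemma energy_le_of_isDiffeo {N : Set (Eucl p)} (hN : IsCompact N)
    (hmin : IsEnergyMinimizing univ N φ) (hG : HasWeakGradient φ G) {ζ F : Eucl n → Eucl n}
    {t : ℝ} (d : IsDiffeo (fun x => x + t • ζ x) F) {R : ℝ} (hRpos : 0 < R)
    (hR : tsupport ζ ⊆ Metric.ball 0 R) :
    ∫ x in Metric.ball 0 R, ∑ i, ‖G i x‖ ^ 2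
      ≤ ∫ x in Metric.ball 0 R, ∑ i, ‖IsDiffeo.compGradient F G i x‖ ^ 2 := by
  have hli := hmin.locallyIntegrable
  -- A strongly measurable representative, so that `u ∘ F` is measurable.
  let u := hli.aestronglyMeasurable.mk φ
  have huφ : ∀ᵐ x, φ x = u x := hli.aestronglyMeasurable.ae_eq_mk
  have hum : StronglyMeasurable u := hli.aestronglyMeasurable.stronglyMeasurable_mk
  have huG : HasWeakGradient u G := hG.congr huφ
  have huli : LocallyIntegrable u := hli.congr huφ
  have himg := d.image_ball hR
  have hgrad := d.isL2Gradient_compGradient huG huli himg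
  have huN : ∀ᵐ x, u x ∈ N := by
    have h1 := hmin.1.2
    rw [Measure.restrict_univ] at h1
    filter_upwards [h1, huφ] with x hx hx'
    rwa [← hx']
  have hFN : ∀ᵐ x, u (F x) ∈ N := d.ae_comp_inv huN
  have hfin : IsFiniteMeasure (volume.restrict (Metric.ball (0 : Eucl n) R)) :=
    ⟨by rw [Measure.restrict_apply_univ]; exact measure_ball_lt_top⟩
  obtain ⟨C, hC⟩ := hN.isBounded.exists_norm_le
  have hmem : MemLp (u ∘ F) 2 (volume.restrict (Metric.ball (0 : Eucl n) R)) := by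
    refine MemLp.of_bound
      (hum.comp_measurable d.contDiff_inv.continuous.measurable).aestronglyMeasurable C ?_
    filter_upwards [ae_restrict_of_ae hFN] with x hx
    exact hC _ hx
  have hle := hmin.2 0 R hRpos (subset_univ _) (u ∘ F)
    ⟨⟨hmem, _, hgrad⟩, ae_restrict_of_ae hFN⟩ ⟨(tsupport ζ)ᶜ, (isClosed_tsupport ζ).isOpen_compl, ?_, ?_⟩
  · rw [hG.energy_ball, energy_eq Metric.isOpen_ball hgrad] at hle
    exact hle
  · intro x hx hx'
    have h1 := hR hx'
    rw [Metric.mem_sphere] at hx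
    rw [Metric.mem_ball] at h1
    linarith
  · rw [ae_restrict_iff' ((isClosed_tsupport ζ).isOpen_compl.inter
      Metric.isOpen_ball).measurableSet]
    filter_upwards [huφ] with x hx hxU
    have h0 : ζ x = 0 := image_eq_zero_of_notMem_tsupport hxU.1
    have h1 : F x = x := by
      have := d.left_inv x
      simpa [h0] using this
    rw [Function.comp_apply, h1, hx]

/-- The first variation formula for domain variations of an energy minimizing map. -/
theorem integral_firstVar_eq_zero {N : Set (Eucl p)} (hN : IsCompact N)
    (hmin : IsEnergyMinimizing univ N φ) (hG : HasWeakGradient φ G) {ζ : Eucl n → Eucl n}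
    (hζ : ContDiff ℝ ∞ ζ) (hζc : HasCompactSupport ζ) :
    ∫ x, firstVar (fderiv ℝ ζ x) (fun i => G i x) = 0 := by
  obtain ⟨R, hRpos, hR⟩ : ∃ R > 0, tsupport ζ ⊆ Metric.ball 0 R := by
    obtain ⟨R, hR⟩ := hζc.isCompact.isBounded.subset_ball (0 : Eucl n)
    exact ⟨max R 1, by positivity, hR.trans (Metric.ball_subset_ball (le_max_left _ _))⟩
  have hloc : ∫ x, firstVar (fderiv ℝ ζ x) (fun i => G i x)
      = ∫ x in Metric.ball 0 R, firstVar (fderiv ℝ ζ x) (fun i => G i x) := by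
    refine (setIntegral_eq_integral_of_forall_compl_eq_zero fun x hx => ?_).symm
    rw [fderiv_eq_zero_of_notMem_tsupport (fun h => hx (hR h))]
    simp [firstVar]
  rw [hloc]
  set I := ∫ x in Metric.ball 0 R, firstVar (fderiv ℝ ζ x) (fun i => G i x)
  set E := ∫ x in Metric.ball 0 R, ∑ i, ‖G i x‖ ^ 2 with hE
  have hE0 : 0 ≤ E := integral_nonneg fun x => Finset.sum_nonneg fun i _ => by positivity
  obtain ⟨K, hK⟩ := ContDiff.lipschitzWith_of_hasCompactSupport hζc hζ (by simp)
  have hζd : Continuous (fderiv ℝ ζ) := hζ.continuous_fderiv (by simp)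
  have hnorm : ∀ x, ‖fderiv ℝ ζ x‖ ≤ K := fun x => norm_fderiv_le_of_lipschitz ℝ hK
  -- Minimality says that the energy does not drop, and the expansion leaves `t I` plus an error
  -- that is `ε` times a linear term. Having both `t = s` and `t = -s` bounds `|I|` by `ε K E`.
  have key : ∀ ε > 0, ∃ s > 0, ∀ t : ℝ, |t| = s → 0 ≤ t * I + ε * (s * K) * E := by
    intro ε hε
    obtain ⟨δ, hδ, hexp⟩ := exists_energy_expansion n hε
    -- The first bound makes `id + tζ` a diffeomorphism; the second puts `t Dζ` in the range of the
    -- expansion at every point.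
    obtain ⟨s, hs, hsK, hsδ⟩ : ∃ s > 0, s * (K : ℝ) < 1 ∧ s * (K : ℝ) < δ := by
      refine ⟨min 1 δ / (K + 1), by positivity, ?_, ?_⟩
      · rw [div_mul_eq_mul_div, div_lt_iff₀ (by positivity)]
        have h1 := min_le_left 1 δ
        have : 0 < min 1 δ := by positivity
        nlinarith [K.coe_nonneg]
      · rw [div_mul_eq_mul_div, div_lt_iff₀ (by positivity)]
        have h1 := min_le_right 1 δ
        nlinarith [K.coe_nonneg]
    refine ⟨s, hs, fun t ht => ?_⟩
    have htn : ‖t‖₊ * K < 1 := by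
      rw [← NNReal.coe_lt_coe]
      simpa [ht] using hsK
    have htζ : ContDiff ℝ ∞ fun x => t • ζ x := hζ.const_smul t
    obtain ⟨F, hF, hl, hr⟩ := exists_contDiff_inverse_id_add (ξ := fun x => t • ζ x)
      htζ htn ((lipschitzWith_smul t).comp hK)
    have d : IsDiffeo (fun x => x + t • ζ x) F :=
      ⟨contDiff_id.add htζ, hF, hl, hr⟩
    have hle := energy_le_of_isDiffeo hN hmin hG d hRpos hR
    rw [d.setIntegral_sq_compGradient measurableSet_ball (d.image_ball hR)] at hle
    have hfd : ∀ z, fderiv ℝ (fun x => x + t • ζ x) z = 1 + t • fderiv ℝ ζ z := by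
      intro z
      have hd := (hζ.differentiable (by simp)).differentiableAt (x := z)
      exact ((hasFDerivAt_id z).add (hd.hasFDerivAt.const_smul t)).fderiv
    have hle2 : ∫ z in Metric.ball 0 R, |(fderiv ℝ (fun x => x + t • ζ x) z).det| *
          ∑ i, ‖∑ j, (fderiv ℝ F (z + t • ζ z) (EuclideanSpace.single i 1)) j • G j z‖ ^ 2
        ≤ ∫ z in Metric.ball 0 R, ((∑ i, ‖G i z‖ ^ 2 +
          t * firstVar (fderiv ℝ ζ z) (fun i => G i z)) + ε * (s * K) * ∑ i, ‖G i z‖ ^ 2) := by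
      refine integral_mono_of_nonneg (ae_of_all _ fun z => by positivity) ?_
        (ae_of_all _ fun z => ?_)
      · exact ((hG.integrableOn_sum_sq 0 R).add
          ((hG.integrableOn_firstVar hζd 0 R).const_mul t)).add
          ((hG.integrableOn_sum_sq 0 R).const_mul _)
      · have hB : ‖t • fderiv ℝ ζ z‖ ≤ s * K := by
          rw [norm_smul, Real.norm_eq_abs, ht]
          exact mul_le_mul_of_nonneg_left (hnorm z) hs.le
        obtain ⟨hdet, hexp'⟩ := hexp _ (hB.trans_lt hsδ)
        have h1 := hexp' (fun i => G i z)
        have h2 := d.fderiv_inv_eq z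
        simp only [hfd] at h2 ⊢
        rw [h2, abs_of_pos hdet]
        refine h1.trans ?_
        rw [firstVar_smul]
        gcongr
    have hsplit : ∫ z in Metric.ball 0 R, ((∑ i, ‖G i z‖ ^ 2 +
          t * firstVar (fderiv ℝ ζ z) (fun i => G i z)) + ε * (s * K) * ∑ i, ‖G i z‖ ^ 2)
        = E + t * I + ε * (s * K) * E := by
      rw [integral_add, integral_add, integral_const_mul, integral_const_mul]
      · exact hG.integrableOn_sum_sq 0 R
      · exact (hG.integrableOn_firstVar hζd 0 R).const_mul t
      · exact (hG.integrableOn_sum_sq 0 R).add ((hG.integrableOn_firstVar hζd 0 R).const_mul t)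
      · exact (hG.integrableOn_sum_sq 0 R).const_mul _
    rw [hsplit] at hle2
    have := hle.trans hle2
    linarith
  have habs : ∀ ε > 0, |I| ≤ ε * (K * E) := by
    intro ε hε
    obtain ⟨s, hs, h⟩ := key ε hε
    have h1 := h s (abs_of_pos hs)
    have h2 := h (-s) (by rw [abs_neg, abs_of_pos hs])
    rw [abs_le]
    constructor
    · refine le_of_mul_le_mul_left (a := s) ?_ hs
      linarith
    · refine le_of_mul_le_mul_left (a := s) ?_ hs
      linarith
  by_contra hne
  have hpos : 0 < |I| := abs_pos.2 hne
  have hKE : 0 ≤ K * E := by positivity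
  -- With this `ε` the bound would give `|I| ≤ |I| / 2`.
  have h1 := habs (|I| / (2 * (K * E + 1))) (by positivity)
  rw [div_mul_eq_mul_div, le_div_iff₀ (by positivity)] at h1
  nlinarith

end variation

/-! ### Radial vector fields and their cut-off profiles. -/

section radial

variable {n p : ℕ} {u φ : Eucl n → Eucl p} {G : Fin n → Eucl n → Eucl p}

/-- The weak derivative of `u` at `x` in the direction `x - y`. -/
def radialDeriv (G : Fin n → Eucl n → Eucl p) (y x : Eucl n) : Eucl p :=
  ∑ i, (x - y) i • G i x

/-- The derivative of a radial field `η(|x - y|²)(x - y)` has this shape with `v = x - y`; the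
rank-one part produces the radial derivative. -/
lemma firstVar_of_rank_one {B : Eucl n →L[ℝ] Eucl n} {a b : ℝ} {v : Eucl n}
    (hB : ∀ w, B w = a • w + (b * inner ℝ v w) • v) (g : Fin n → Eucl p) :
    firstVar B g = (((n : ℝ) - 2) * a + b * ‖v‖ ^ 2) * ∑ i, ‖g i‖ ^ 2
      - 2 * b * ‖∑ i, v i • g i‖ ^ 2 := by
  have h1 : ∀ i j, B (EuclideanSpace.single i 1) j = (if i = j then a else 0) + b * (v i * v j) := by
    intro i j
    rw [hB]
    simp [eq_comm (a := j), EuclideanSpace.inner_single_right]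
    ring
  have h2 : ∑ i, B (EuclideanSpace.single i 1) i = n * a + b * ‖v‖ ^ 2 := by
    simp_rw [h1, Finset.sum_add_distrib, ← Finset.mul_sum, EuclideanSpace.real_norm_sq_eq]
    simp [sq]
  have h3 : ∑ i, ∑ j, B (EuclideanSpace.single i 1) j * inner ℝ (g i) (g j)
      = a * ∑ i, ‖g i‖ ^ 2 + b * ‖∑ i, v i • g i‖ ^ 2 := by
    rw [← real_inner_self_eq_norm_sq (∑ i, v i • g i)]
    simp_rw [h1, add_mul, Finset.sum_add_distrib, sum_inner, inner_sum, inner_smul_left,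
      inner_smul_right, Finset.mul_sum]
    congr 1
    · simp
    · refine Finset.sum_congr rfl fun i _ => Finset.sum_congr rfl fun j _ => ?_
      simp
      ring
  rw [firstVar, h2, h3]
  ring

/-- The first variation formula for the radial vector field `η(|x - y|²) (x - y)`. -/
lemma integral_radial_eq_zero {N : Set (Eucl p)} (hN : IsCompact N)
    (hmin : IsEnergyMinimizing univ N φ) (hG : HasWeakGradient φ G) (y : Eucl n) {η : ℝ → ℝ}
    (hη : ContDiff ℝ ∞ η) {ρ : ℝ} (hρ : 0 < ρ) (h0 : ∀ s, ρ ^ 2 ≤ s → η s = 0) :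
    ∫ x, ((((n : ℝ) - 2) * η (‖x - y‖ ^ 2) + 2 * deriv η (‖x - y‖ ^ 2) * ‖x - y‖ ^ 2)
      * ∑ i, ‖G i x‖ ^ 2 - 4 * deriv η (‖x - y‖ ^ 2) * ‖radialDeriv G y x‖ ^ 2) = 0 := by
  have hsub : ContDiff ℝ ∞ fun x : Eucl n => x - y := contDiff_id.sub contDiff_const
  have hζ : ContDiff ℝ ∞ fun x : Eucl n => η (‖x - y‖ ^ 2) • (x - y) :=
    (hη.comp (hsub.norm_sq ℝ)).smul hsub
  have hζc : HasCompactSupport fun x : Eucl n => η (‖x - y‖ ^ 2) • (x - y) := by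
    refine HasCompactSupport.intro (isCompact_closedBall y ρ) fun x hx => ?_
    rw [Metric.mem_closedBall, dist_eq_norm, not_le] at hx
    rw [h0 _ (by gcongr), zero_smul]
  rw [← integral_firstVar_eq_zero hN hmin hG hζ hζc]
  congr 1
  funext x
  have hB : ∀ w, fderiv ℝ (fun x : Eucl n => η (‖x - y‖ ^ 2) • (x - y)) x w
      = η (‖x - y‖ ^ 2) • w + (2 * deriv η (‖x - y‖ ^ 2) * inner ℝ (x - y) w) • (x - y) := by
    intro w
    have hd1 : HasFDerivAt (fun x : Eucl n => x - y) (ContinuousLinearMap.id ℝ (Eucl n)) x :=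
      (hasFDerivAt_id x).sub_const y
    have hd2 := hd1.norm_sq
    have hd3 := ((hη.differentiable (by simp)).differentiableAt
      (x := ‖x - y‖ ^ 2)).hasDerivAt.comp_hasFDerivAt x hd2
    have hd4 := hd3.fun_smul hd1
    simp only [Function.comp_apply] at hd4
    rw [hd4.fderiv]
    simp [inner_sub_left]
    ring_nf
  rw [firstVar_of_rank_one hB]
  simp only [radialDeriv]
  ring

/-- A smooth approximation of the indicator function of `(a, b)`. -/
def smoothCutoff (a b : ℝ) (k : ℕ) (s : ℝ) : ℝ := Real.smoothTransition (k * ((s - a) * (b - s)))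

lemma contDiff_smoothCutoff (a b : ℝ) (k : ℕ) : ContDiff ℝ ∞ (smoothCutoff a b k) := by
  unfold smoothCutoff
  exact Real.smoothTransition.contDiff.comp (by fun_prop)

lemma smoothCutoff_eq_zero {a b : ℝ} (hab : a ≤ b) (k : ℕ) {s : ℝ} (hs : s ∉ Ioo a b) :
    smoothCutoff a b k s = 0 := by
  apply Real.smoothTransition.zero_of_nonpos
  apply mul_nonpos_of_nonneg_of_nonpos (Nat.cast_nonneg k)
  rw [mem_Ioo, not_and_or, not_lt, not_lt] at hs
  rcases hs with hs | hs
  · exact mul_nonpos_of_nonpos_of_nonneg (by linarith) (by linarith)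
  · exact mul_nonpos_of_nonneg_of_nonpos (by linarith) (by linarith)

lemma abs_smoothCutoff_le (a b : ℝ) (k : ℕ) (s : ℝ) : |smoothCutoff a b k s| ≤ 1 := by
  rw [smoothCutoff, abs_of_nonneg (Real.smoothTransition.nonneg _)]
  exact Real.smoothTransition.le_one _

lemma tendsto_smoothCutoff {a b : ℝ} (hab : a ≤ b) (s : ℝ) :
    Tendsto (fun k => smoothCutoff a b k s) atTop (𝓝 ((Ioo a b).indicator 1 s)) := by
  by_cases hs : s ∈ Ioo a b
  · rw [indicator_of_mem hs]
    have hpos : 0 < (s - a) * (b - s) := mul_pos (by linarith [hs.1]) (by linarith [hs.2])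
    obtain ⟨K, hK⟩ := exists_nat_gt (1 / ((s - a) * (b - s)))
    refine tendsto_const_nhds.congr' ?_
    filter_upwards [eventually_ge_atTop K] with k hk
    refine (Real.smoothTransition.one_of_one_le ?_).symm
    rw [div_lt_iff₀ hpos] at hK
    have : (K : ℝ) ≤ k := by exact_mod_cast hk
    nlinarith
  · rw [indicator_of_notMem hs]
    simp only [smoothCutoff_eq_zero hab _ hs]
    exact tendsto_const_nhds

/-- The weight `½ s^{-n/2}` on `(a, b)`, smoothly cut off. -/
def cutWeight (n : ℕ) (a b : ℝ) (k : ℕ) (s : ℝ) : ℝ :=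
  1 / 2 * (√s) ^ (-(n : ℤ)) * smoothCutoff a b k s

variable {σ ρ : ℝ}

/-- The singularity of the power at `0` is invisible because the cutoff vanishes below `σ²`. -/
lemma contDiff_cutWeight (n : ℕ) (hσ : 0 < σ) (hσρ : σ < ρ) (k : ℕ) :
    ContDiff ℝ ∞ (cutWeight n (σ ^ 2) (ρ ^ 2) k) := by
  rw [contDiff_iff_contDiffAt]
  intro s
  have hσ2 : 0 < σ ^ 2 := by positivity
  rcases lt_or_ge s (σ ^ 2) with hs | hs
  · refine (contDiffAt_const (c := (0 : ℝ))).congr_of_eventuallyEq ?_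
    filter_upwards [eventually_lt_nhds hs] with t ht
    rw [cutWeight, smoothCutoff_eq_zero (by gcongr) k (fun h => lt_asymm ht h.1), mul_zero]
  · have hs0 : s ≠ 0 := by linarith
    have hs1 : √s ≠ 0 := (Real.sqrt_pos.2 (by linarith)).ne'
    refine ContDiffAt.mul (ContDiffAt.mul contDiffAt_const ?_)
      (contDiff_smoothCutoff _ _ k).contDiffAt
    simp_rw [zpow_neg, zpow_natCast]
    exact ((Real.contDiffAt_sqrt hs0).pow n).inv (pow_ne_zero _ hs1)

lemma abs_cutWeight_le (n : ℕ) (hσ : 0 < σ) (hσρ : σ < ρ) (k : ℕ) (s : ℝ) :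
    |cutWeight n (σ ^ 2) (ρ ^ 2) k s| ≤ (σ ^ n)⁻¹ := by
  by_cases hs : s ∈ Ioo (σ ^ 2) (ρ ^ 2)
  · have h1 : σ ≤ √s := Real.le_sqrt_of_sq_le hs.1.le
    rw [cutWeight, abs_mul, abs_mul, zpow_neg, zpow_natCast, abs_of_pos (a := (√s ^ n)⁻¹)
      (inv_pos.2 (pow_pos (by linarith) _))]
    have h2 : (√s ^ n)⁻¹ ≤ (σ ^ n)⁻¹ := by gcongr
    have h3 := abs_smoothCutoff_le (σ ^ 2) (ρ ^ 2) k s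
    have h4 : 0 ≤ (√s ^ n)⁻¹ := by positivity
    have h5 : |(1 / 2 : ℝ)| = 1 / 2 := by norm_num
    rw [h5]
    nlinarith [abs_nonneg (smoothCutoff (σ ^ 2) (ρ ^ 2) k s)]
  · rw [cutWeight, smoothCutoff_eq_zero (by gcongr) k hs, mul_zero, abs_zero]
    positivity

lemma tendsto_cutWeight (n : ℕ) (hσ : 0 < σ) (hσρ : σ < ρ) (s : ℝ) :
    Tendsto (fun k => cutWeight n (σ ^ 2) (ρ ^ 2) k s) atTop
      (𝓝 ((Ioo (σ ^ 2) (ρ ^ 2)).indicator (fun s => 1 / 2 * (√s) ^ (-(n : ℤ))) s)) := by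
  have h := (tendsto_smoothCutoff (a := σ ^ 2) (b := ρ ^ 2) (by gcongr) s).const_mul
    (1 / 2 * (√s) ^ (-(n : ℤ)))
  convert! h using 2
  by_cases hs : s ∈ Ioo (σ ^ 2) (ρ ^ 2) <;> simp [hs]

/-- The reason for the weight `½ s^{-n/2}`: its primitive, times `n - 2`, is a power of `√s` that
later cancels against the term `2 s η'`. Keeping the factor `n - 2` on the left covers `n = 2`
without a logarithm. -/
lemma integral_sqrt_zpow (n : ℕ) {a b : ℝ} (ha : 0 < a) (hab : a ≤ b) :
    ((n : ℝ) - 2) * ∫ t in a..b, 1 / 2 * (√t) ^ (-(n : ℤ))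
      = (√a) ^ (2 - (n : ℤ)) - (√b) ^ (2 - (n : ℤ)) := by
  have hpos : ∀ t ∈ uIcc a b, 0 < t := fun t ht => by
    rw [uIcc_of_le hab] at ht
    exact ha.trans_le ht.1
  have hd : ∀ t ∈ uIcc a b, HasDerivAt (fun t => -(√t) ^ (2 - (n : ℤ)))
      (((n : ℝ) - 2) * (1 / 2 * (√t) ^ (-(n : ℤ)))) t := by
    intro t ht
    have ht0 := hpos t ht
    have hs : 0 < √t := Real.sqrt_pos.2 ht0
    have h1 := ((hasDerivAt_zpow (2 - (n : ℤ)) (√t) (Or.inl hs.ne')).comp t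
      (Real.hasDerivAt_sqrt ht0.ne')).neg
    refine h1.congr_deriv ?_
    have h2 : (√t) ^ (2 - (n : ℤ) - 1) = (√t) ^ (-(n : ℤ)) * √t := by
      rw [← zpow_add_one₀ hs.ne']
      congr 1
      ring
    rw [h2]
    push_cast
    field_simp
    ring
  rw [← intervalIntegral.integral_const_mul, intervalIntegral.integral_eq_sub_of_hasDerivAt hd]
  · ring
  · apply ContinuousOn.intervalIntegrable
    refine continuousOn_const.mul (continuousOn_const.mul ?_)
    exact ContinuousOn.zpow₀ Real.continuous_sqrt.continuousOn _
      fun t ht => Or.inl (Real.sqrt_pos.2 (hpos t ht)).ne'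

/-- The primitive of `-cutWeight` vanishing for large arguments. -/
def cutPrimitive (n : ℕ) (a b : ℝ) (k : ℕ) (s : ℝ) : ℝ := ∫ t in s..b, cutWeight n a b k t

lemma hasDerivAt_cutPrimitive (n : ℕ) (hσ : 0 < σ) (hσρ : σ < ρ) (k : ℕ) (s : ℝ) :
    HasDerivAt (cutPrimitive n (σ ^ 2) (ρ ^ 2) k) (-cutWeight n (σ ^ 2) (ρ ^ 2) k s) s := by
  have hc := (contDiff_cutWeight n hσ hσρ k).continuous
  exact intervalIntegral.integral_hasDerivAt_left (hc.intervalIntegrable _ _)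
    (hc.stronglyMeasurableAtFilter _ _) hc.continuousAt

lemma deriv_cutPrimitive (n : ℕ) (hσ : 0 < σ) (hσρ : σ < ρ) (k : ℕ) (s : ℝ) :
    deriv (cutPrimitive n (σ ^ 2) (ρ ^ 2) k) s = -cutWeight n (σ ^ 2) (ρ ^ 2) k s :=
  (hasDerivAt_cutPrimitive n hσ hσρ k s).deriv

lemma contDiff_cutPrimitive (n : ℕ) (hσ : 0 < σ) (hσρ : σ < ρ) (k : ℕ) :
    ContDiff ℝ ∞ (cutPrimitive n (σ ^ 2) (ρ ^ 2) k) := by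
  rw [contDiff_infty_iff_deriv]
  refine ⟨fun s => (hasDerivAt_cutPrimitive n hσ hσρ k s).differentiableAt, ?_⟩
  rw [funext (deriv_cutPrimitive n hσ hσρ k)]
  exact (contDiff_cutWeight n hσ hσρ k).neg

lemma cutPrimitive_eq_zero (n : ℕ) (hσ : 0 < σ) (hσρ : σ < ρ) (k : ℕ) {s : ℝ}
    (hs : ρ ^ 2 ≤ s) : cutPrimitive n (σ ^ 2) (ρ ^ 2) k s = 0 := by
  refine intervalIntegral.integral_zero_ae (ae_of_all _ fun t ht => ?_)
  rw [uIoc_of_ge hs] at ht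
  rw [cutWeight, smoothCutoff_eq_zero (by gcongr) k (fun h => lt_asymm ht.1 h.2), mul_zero]

lemma abs_cutPrimitive_le (n : ℕ) (hσ : 0 < σ) (hσρ : σ < ρ) (k : ℕ) {s : ℝ} (hs0 : 0 ≤ s)
    (hs : s ≤ ρ ^ 2) : |cutPrimitive n (σ ^ 2) (ρ ^ 2) k s| ≤ (σ ^ n)⁻¹ * ρ ^ 2 := by
  have h := intervalIntegral.norm_integral_le_of_norm_le_const (a := s) (b := ρ ^ 2)
    (f := cutWeight n (σ ^ 2) (ρ ^ 2) k) fun t _ => abs_cutWeight_le n hσ hσρ k t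
  refine h.trans ?_
  gcongr
  rw [abs_of_nonneg (by linarith)]
  linarith

/-- The maximum treats the inner ball and the annulus together, since the limiting weight vanishes
below `σ²`. -/
lemma tendsto_cutPrimitive (n : ℕ) (hσ : 0 < σ) (hσρ : σ < ρ) {s : ℝ} (hs : s ≤ ρ ^ 2) :
    Tendsto (fun k => ((n : ℝ) - 2) * cutPrimitive n (σ ^ 2) (ρ ^ 2) k s) atTop
      (𝓝 ((√(max s (σ ^ 2))) ^ (2 - (n : ℤ)) - ρ ^ (2 - (n : ℤ)))) := by
  have hlim : Tendsto (fun k => cutPrimitive n (σ ^ 2) (ρ ^ 2) k s) atTop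
      (𝓝 (∫ t in s..ρ ^ 2,
        (Ioo (σ ^ 2) (ρ ^ 2)).indicator (fun s => 1 / 2 * (√s) ^ (-(n : ℤ))) t)) := by
    refine intervalIntegral.tendsto_integral_filter_of_dominated_convergence
      (fun _ => (σ ^ n)⁻¹) ?_ ?_ ?_ ?_
    · exact Eventually.of_forall fun k =>
        (contDiff_cutWeight n hσ hσρ k).continuous.aestronglyMeasurable
    · exact Eventually.of_forall fun k => ae_of_all _ fun t _ => abs_cutWeight_le n hσ hσρ k t
    · exact intervalIntegrable_const
    · exact ae_of_all _ fun t _ => tendsto_cutWeight n hσ hσρ t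
  have hσ2 : σ ^ 2 ≤ ρ ^ 2 := by gcongr
  have heq : ∫ t in s..ρ ^ 2,
        (Ioo (σ ^ 2) (ρ ^ 2)).indicator (fun s => 1 / 2 * (√s) ^ (-(n : ℤ))) t
      = ∫ t in (max s (σ ^ 2))..ρ ^ 2, 1 / 2 * (√t) ^ (-(n : ℤ)) := by
    rw [intervalIntegral.integral_of_le hs, intervalIntegral.integral_of_le (max_le hs hσ2),
      setIntegral_indicator measurableSet_Ioo, integral_Ioc_eq_integral_Ioo]
    have : Ioc s (ρ ^ 2) ∩ Ioo (σ ^ 2) (ρ ^ 2) = Ioo (max s (σ ^ 2)) (ρ ^ 2) := by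
      ext t
      simp only [mem_inter_iff, mem_Ioc, mem_Ioo, max_lt_iff]
      constructor
      · rintro ⟨⟨h1, -⟩, h2, h3⟩
        exact ⟨⟨h1, h2⟩, h3⟩
      · rintro ⟨⟨h1, h2⟩, h3⟩
        exact ⟨⟨h1, h3.le⟩, h2, h3⟩
    rw [this]
  have h := hlim.const_mul ((n : ℝ) - 2)
  rw [heq, integral_sqrt_zpow n (lt_max_of_lt_right (by positivity)) (max_le hs hσ2),
    Real.sqrt_sq (hσ.trans hσρ).le] at h
  exact h

end radial

/-! ### The monotonicity formula. -/

section monotonicity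

variable {n p : ℕ} {u φ : Eucl n → Eucl p} {G : Fin n → Eucl n → Eucl p}

lemma HasWeakGradient.integrableOn_radialDeriv_sq (hG : HasWeakGradient u G) (y z : Eucl n)
    (ρ : ℝ) : IntegrableOn (fun x => ‖radialDeriv G y x‖ ^ 2) (Metric.ball z ρ) := by
  refine MemLp.integrable_norm_pow (p := 2) ?_ (by simp)
  refine memLp_finsetSum _ fun j _ => MemLp.continuous_smul_ball ?_
    (hG.memLp_of_isBounded Metric.isBounded_ball j)
  exact (contDiff_coord j).continuous.comp (continuous_id.sub continuous_const)

/-- `∫_{B_ρ(y)} |Du|²` scaled by `ρ^{2-n}`, expressed through the gradient `G`. -/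
def gradEnergy (G : Fin n → Eucl n → Eucl p) (y : Eucl n) (ρ : ℝ) : ℝ :=
  ρ ^ (2 - (n : ℤ)) * ∫ x in Metric.ball y ρ, ∑ i, ‖G i x‖ ^ 2

lemma HasWeakGradient.scaledEnergy_eq (hG : HasWeakGradient u G) :
    scaledEnergy u = gradEnergy G := by
  funext y ρ
  rw [scaledEnergy, gradEnergy, hG.energy_ball]

lemma HasWeakGradient.integrableOn_radial_weight (hG : HasWeakGradient u G) (y : Eucl n)
    {σ ρ : ℝ} (hσ : 0 < σ) :
    IntegrableOn (fun x => ‖x - y‖ ^ (-(n : ℤ)) * ‖radialDeriv G y x‖ ^ 2)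
      (Metric.ball y ρ \ Metric.closedBall y σ) := by
  refine Integrable.bdd_mul (c := (σ ^ n)⁻¹)
    ((hG.integrableOn_radialDeriv_sq y y ρ).mono_set sdiff_subset) ?_ ?_
  · have : Measurable fun x : Eucl n => ‖x - y‖ ^ (-(n : ℤ)) := by
      simp_rw [zpow_neg, zpow_natCast]
      exact ((measurable_id.sub_const y).norm.pow_const n).inv
    exact this.aestronglyMeasurable
  · rw [ae_restrict_iff' (measurableSet_ball.diff measurableSet_closedBall)]
    refine ae_of_all _ fun x hx => ?_
    have h1 : σ < ‖x - y‖ := by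
      have := hx.2
      rwa [Metric.mem_closedBall, dist_eq_norm, not_le] at this
    rw [zpow_neg, zpow_natCast, Real.norm_of_nonneg (by positivity)]
    gcongr

/-- The monotonicity formula. -/
theorem gradEnergy_sub_gradEnergy {N : Set (Eucl p)} (hN : IsCompact N)
    (hmin : IsEnergyMinimizing univ N φ) (hG : HasWeakGradient φ G) (y : Eucl n)
    {σ ρ : ℝ} (hσ : 0 < σ) (hσρ : σ < ρ) :
    gradEnergy G y ρ - gradEnergy G y σ
      = 2 * ∫ x in Metric.ball y ρ \ Metric.closedBall y σ,
          ‖x - y‖ ^ (-(n : ℤ)) * ‖radialDeriv G y x‖ ^ 2 := by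
  have hρ : 0 < ρ := hσ.trans hσρ
  set S : Eucl n → ℝ := fun x => ∑ i, ‖G i x‖ ^ 2 with hS
  set D : Eucl n → ℝ := fun x => ‖radialDeriv G y x‖ ^ 2 with hD
  have hSi : IntegrableOn S (Metric.ball y ρ) := hG.integrableOn_sum_sq y ρ
  have hDi : IntegrableOn D (Metric.ball y ρ) := hG.integrableOn_radialDeriv_sq y y ρ
  have hS0 : ∀ x, 0 ≤ S x := fun x => Finset.sum_nonneg fun i _ => by positivity
  have hD0 : ∀ x, 0 ≤ D x := fun x => by positivity
  -- The radial first variation with `η` equal to `cutPrimitive`, so that `η'` is minus `cutWeight`.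
  let J : ℕ → Eucl n → ℝ := fun k x =>
    (((n : ℝ) - 2) * cutPrimitive n (σ ^ 2) (ρ ^ 2) k (‖x - y‖ ^ 2)
      - 2 * cutWeight n (σ ^ 2) (ρ ^ 2) k (‖x - y‖ ^ 2) * ‖x - y‖ ^ 2) * S x
    + 4 * cutWeight n (σ ^ 2) (ρ ^ 2) k (‖x - y‖ ^ 2) * D x
  have hJ0 : ∀ k, ∫ x in Metric.ball y ρ, J k x = 0 := by
    intro k
    have h := integral_radial_eq_zero hN hmin hG y (contDiff_cutPrimitive n hσ hσρ k) hρ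
      fun s hs => cutPrimitive_eq_zero n hσ hσρ k hs
    refine Eq.trans ?_ ((setIntegral_eq_integral_of_forall_compl_eq_zero
      (s := Metric.ball y ρ) ?_).trans h)
    · refine setIntegral_congr_fun measurableSet_ball fun x _ => ?_
      simp only [J, deriv_cutPrimitive n hσ hσρ]
      ring
    · intro x hx
      rw [Metric.mem_ball, dist_eq_norm, not_lt] at hx
      have hx2 : ρ ^ 2 ≤ ‖x - y‖ ^ 2 := by gcongr
      rw [cutPrimitive_eq_zero n hσ hσρ k hx2, deriv_cutPrimitive n hσ hσρ, cutWeight,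
        smoothCutoff_eq_zero (by gcongr) k (fun h => by linarith [h.2])]
      simp
  -- The pointwise limit of `J k` on the ball. On the annulus the two `|x - y|^{2-n}` terms cancel,
  -- leaving `-ρ^{2-n}` in front of `S`; on the inner ball the weight is zero and `σ^{2-n} -
  -- ρ^{2-n}` remains.
  let L : Eucl n → ℝ := fun x => -ρ ^ (2 - (n : ℤ)) * S x
    + (Metric.closedBall y σ).indicator (fun x => σ ^ (2 - (n : ℤ)) * S x) x
    + (Metric.closedBall y σ)ᶜ.indicator (fun x => 2 * (‖x - y‖ ^ (-(n : ℤ)) * D x)) x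
  have hlim : Tendsto (fun k => ∫ x in Metric.ball y ρ, J k x) atTop
      (𝓝 (∫ x in Metric.ball y ρ, L x)) := by
    refine tendsto_integral_of_dominated_convergence (fun x =>
      (|(n : ℝ) - 2| * ((σ ^ n)⁻¹ * ρ ^ 2) + 2 * (σ ^ n)⁻¹ * ρ ^ 2) * S x
        + 4 * (σ ^ n)⁻¹ * D x) ?_ ?_ ?_ ?_
    · intro k
      have hc : Continuous fun x : Eucl n => ‖x - y‖ ^ 2 := by fun_prop
      have c1 := (contDiff_cutPrimitive n hσ hσρ k).continuous.comp hc
      have c2 := (contDiff_cutWeight n hσ hσρ k).continuous.comp hc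
      refine AEStronglyMeasurable.add (AEStronglyMeasurable.mul ?_ hSi.1)
        (AEStronglyMeasurable.mul ?_ hDi.1)
      · exact ((c1.const_smul ((n : ℝ) - 2)).sub
          ((c2.const_smul (2 : ℝ)).mul hc)).aestronglyMeasurable
      · exact (c2.const_smul (4 : ℝ)).aestronglyMeasurable
    · exact (hSi.const_mul _).add (hDi.const_mul _)
    · intro k
      rw [ae_restrict_iff' measurableSet_ball]
      refine ae_of_all _ fun x hx => ?_
      rw [Metric.mem_ball, dist_eq_norm] at hx
      have hx2 : ‖x - y‖ ^ 2 ≤ ρ ^ 2 := by gcongr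
      have b1 := abs_cutPrimitive_le n hσ hσρ k (sq_nonneg ‖x - y‖) hx2
      have b2 := abs_cutWeight_le n hσ hσρ k (‖x - y‖ ^ 2)
      rw [Real.norm_eq_abs]
      refine (abs_add_le _ _).trans ?_
      rw [abs_mul, abs_mul, abs_of_nonneg (hS0 x), abs_of_nonneg (hD0 x)]
      refine add_le_add (mul_le_mul_of_nonneg_right ?_ (hS0 x))
        (mul_le_mul_of_nonneg_right ?_ (hD0 x))
      · refine (abs_sub _ _).trans ?_
        rw [abs_mul, abs_mul, abs_mul, abs_of_nonneg (sq_nonneg ‖x - y‖), abs_two]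
        gcongr
      · rw [abs_mul, abs_of_pos (by norm_num : (0 : ℝ) < 4)]
        gcongr
    · rw [ae_restrict_iff' measurableSet_ball]
      refine ae_of_all _ fun x hx => ?_
      rw [Metric.mem_ball, dist_eq_norm] at hx
      have hx2 : ‖x - y‖ ^ 2 ≤ ρ ^ 2 := by gcongr
      have t1 := tendsto_cutPrimitive n hσ hσρ hx2
      have t2 := tendsto_cutWeight n hσ hσρ (‖x - y‖ ^ 2)
      have t3 := ((t1.sub ((t2.const_mul 2).mul_const (‖x - y‖ ^ 2))).mul_const (S x)).add
        ((t2.const_mul 4).mul_const (D x))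
      convert! t3 using 2
      simp only [L]
      by_cases hxσ : ‖x - y‖ ≤ σ
      · have m1 : x ∈ Metric.closedBall y σ := by rwa [Metric.mem_closedBall, dist_eq_norm]
        have hx3 : ‖x - y‖ ^ 2 ≤ σ ^ 2 := by gcongr
        rw [indicator_of_mem m1, indicator_of_notMem (notMem_compl_iff.2 m1), max_eq_right hx3,
          Real.sqrt_sq hσ.le, indicator_of_notMem (fun h => by linarith [h.1])]
        ring
      · have m1 : x ∉ Metric.closedBall y σ := by rwa [Metric.mem_closedBall, dist_eq_norm]
        rw [not_le] at hxσ
        have hx3 : σ ^ 2 < ‖x - y‖ ^ 2 := by gcongr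
        have hx4 : ‖x - y‖ ^ 2 < ρ ^ 2 := by gcongr
        have hpos : ‖x - y‖ ≠ 0 := by linarith
        rw [indicator_of_notMem m1, indicator_of_mem (mem_compl m1), max_eq_left hx3.le,
          indicator_of_mem (mem_Ioo.2 ⟨hx3, hx4⟩), Real.sqrt_sq (norm_nonneg _)]
        have hz : ‖x - y‖ ^ (2 - (n : ℤ)) = ‖x - y‖ ^ (-(n : ℤ)) * ‖x - y‖ ^ 2 := by
          rw [← zpow_natCast, ← zpow_add₀ hpos]
          congr 1
          push_cast
          ring
        rw [hz]
        ring
  simp only [hJ0] at hlim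
  have hL0 : ∫ x in Metric.ball y ρ, L x = 0 := tendsto_nhds_unique hlim tendsto_const_nhds
  have hsub : Metric.closedBall y σ ⊆ Metric.ball y ρ := Metric.closedBall_subset_ball hσρ
  have hWi : IntegrableOn (fun x => 2 * (‖x - y‖ ^ (-(n : ℤ)) * D x))
      (Metric.ball y ρ \ Metric.closedBall y σ) :=
    (hG.integrableOn_radial_weight y hσ).const_mul 2
  have i1 : IntegrableOn (fun x => -ρ ^ (2 - (n : ℤ)) * S x) (Metric.ball y ρ) := hSi.const_mul _
  have i2 : IntegrableOn ((Metric.closedBall y σ).indicator fun x => σ ^ (2 - (n : ℤ)) * S x)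
      (Metric.ball y ρ) := (hSi.const_mul _).indicator measurableSet_closedBall
  have i3 : IntegrableOn
      ((Metric.closedBall y σ)ᶜ.indicator fun x => 2 * (‖x - y‖ ^ (-(n : ℤ)) * D x))
      (Metric.ball y ρ) := by
    rw [IntegrableOn, integrable_indicator_iff measurableSet_closedBall.compl, IntegrableOn,
      Measure.restrict_restrict measurableSet_closedBall.compl, inter_comm, ← sdiff_eq]
    exact hWi
  have hsplit : ∫ x in Metric.ball y ρ, L x = -ρ ^ (2 - (n : ℤ)) * (∫ x in Metric.ball y ρ, S x)
      + σ ^ (2 - (n : ℤ)) * (∫ x in Metric.ball y σ, S x)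
      + 2 * ∫ x in Metric.ball y ρ \ Metric.closedBall y σ, ‖x - y‖ ^ (-(n : ℤ)) * D x := by
    have hball : ∫ x in Metric.closedBall y σ, S x = ∫ x in Metric.ball y σ, S x := by
      refine setIntegral_congr_set ?_
      rw [← Metric.ball_union_sphere]
      exact union_ae_eq_left_of_ae_eq_empty
        (ae_eq_empty.2 (Measure.addHaar_sphere_of_ne_zero volume y hσ.ne'))
    simp only [L]
    have a1 := integral_add (i1.add i2) i3
    have a2 := integral_add i1 i2
    simp only [Pi.add_apply] at a1 a2
    rw [a1, a2,
      setIntegral_indicator measurableSet_closedBall,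
      setIntegral_indicator measurableSet_closedBall.compl, ← sdiff_eq,
      inter_eq_self_of_subset_right hsub, integral_const_mul, integral_const_mul,
      integral_const_mul, hball]
  rw [hsplit] at hL0
  simp only [gradEnergy]
  linarith

end monotonicity

/-! ### Homogeneous maps: existence of the density and its maximal value. -/

section homogeneous

variable {n p : ℕ} {u φ : Eucl n → Eucl p} {G : Fin n → Eucl n → Eucl p}

lemma isDiffeo_smul {c : ℝ} (hc : 0 < c) :
    IsDiffeo (fun x : Eucl n => c⁻¹ • x) (fun x : Eucl n => c • x) where
  contDiff := contDiff_const_smul c⁻¹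
  contDiff_inv := contDiff_const_smul c
  left_inv := fun x => smul_inv_smul₀ hc.ne' x
  right_inv := fun x => inv_smul_smul₀ hc.ne' x

lemma fderiv_smul_eq (c : ℝ) (x : Eucl n) :
    fderiv ℝ (fun x : Eucl n => c • x) x = c • ContinuousLinearMap.id ℝ (Eucl n) :=
  ((hasFDerivAt_id x).const_smul c).fderiv

lemma image_smul_ball_zero {c : ℝ} (hc : 0 < c) (r : ℝ) :
    (fun x : Eucl n => c⁻¹ • x) '' Metric.ball 0 (c * r) = Metric.ball 0 r := by
  have h := smul_ball (inv_ne_zero hc.ne') (0 : Eucl n) (c * r)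
  rw [smul_zero, Real.norm_of_nonneg (inv_nonneg.2 hc.le), inv_mul_cancel_left₀ hc.ne'] at h
  exact h

lemma sum_smul_id_coord_smul (c : ℝ) (g : Fin n → Eucl p) (i : Fin n) :
    ∑ j, ((c • ContinuousLinearMap.id ℝ (Eucl n)) (EuclideanSpace.single i 1)) j • g j
      = c • g i := by
  rw [Finset.sum_eq_single i]
  · simp
  · intro j _ hj
    simp [hj]
  · simp

lemma hasWeakGradient_comp_smul (hG : HasWeakGradient φ G) (hφ : LocallyIntegrable φ) {c : ℝ}
    (hc : 0 < c) :
    HasWeakGradient (fun x => φ (c • x)) (IsDiffeo.compGradient (fun x => c • x) G) where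
  measurable := (isDiffeo_smul hc).measurable_compGradient hG.measurable
  memLp := fun i R => (isDiffeo_smul hc).memLp_compGradient hG (image_smul_ball_zero hc R) i
  integral_eq := fun _ h1 h2 i => (isDiffeo_smul hc).integral_smul_compGradient hG hφ h1 h2 i

/-- The scaled energy of a map that is homogeneous of degree zero is constant. -/
lemma gradEnergy_zero_eq (hG : HasWeakGradient φ G) (hφ : LocallyIntegrable φ)
    (hhom : ∀ c : ℝ, 0 < c → ∀ᵐ x : Eucl n, φ (c • x) = φ x) {c : ℝ} (hc : 0 < c) :
    gradEnergy G 0 c = gradEnergy G 0 1 := by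
  -- By uniqueness of weak gradients, `c G(cx) = G(x)` a.e. Scaling the unit ball by `c` then gives
  -- the factor `c² c^{-n}`, which is the normalisation.
  have hae : ∀ i, ∀ᵐ x, IsDiffeo.compGradient (fun x => c • x) G i x = G i x := fun i =>
    (hasWeakGradient_comp_smul hG hφ hc).ae_eq hG (hhom c hc) i
  have h1 : ∫ x in Metric.ball 0 1, ∑ i, ‖G i x‖ ^ 2
      = ∫ x in Metric.ball 0 1, ∑ i, ‖IsDiffeo.compGradient (fun x => c • x) G i x‖ ^ 2 := by
    refine integral_congr_ae (ae_restrict_of_ae ?_)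
    filter_upwards [ae_all_iff.2 hae] with x hx
    simp only [hx]
  have hdet : |(c⁻¹ • ContinuousLinearMap.id ℝ (Eucl n)).det| = (c ^ n)⁻¹ := by
    rw [abs_of_nonneg] <;> simp [ContinuousLinearMap.det, LinearMap.det_smul, hc.le]
  have himg := image_smul_ball_zero (n := n) hc 1
  rw [mul_one] at himg
  rw [gradEnergy, gradEnergy, one_zpow, one_mul, h1,
    (isDiffeo_smul hc).setIntegral_sq_compGradient measurableSet_ball himg]
  have hsum : ∀ z, ∑ i, ‖∑ j, ((c • ContinuousLinearMap.id ℝ (Eucl n))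
      (EuclideanSpace.single i 1)) j • G j z‖ ^ 2 = ‖c‖ ^ 2 * ∑ i, ‖G i z‖ ^ 2 := fun z => by
    simp only [sum_smul_id_coord_smul c (fun j => G j z), norm_smul, mul_pow, ← Finset.mul_sum]
  simp only [fderiv_smul_eq, hdet, hsum]
  rw [integral_const_mul, integral_const_mul, ← mul_assoc]
  congr 1
  rw [Real.norm_of_nonneg hc.le, sub_eq_add_neg, zpow_add₀ hc.ne', zpow_neg, zpow_natCast,
    mul_comm]
  norm_cast

lemma gradEnergy_nonneg (G : Fin n → Eucl n → Eucl p) (y : Eucl n) {ρ : ℝ} (hρ : 0 < ρ) :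
    0 ≤ gradEnergy G y ρ :=
  mul_nonneg (by positivity) (integral_nonneg fun x => Finset.sum_nonneg fun i _ => by positivity)

lemma gradEnergy_mono {N : Set (Eucl p)} (hN : IsCompact N)
    (hmin : IsEnergyMinimizing univ N φ) (hG : HasWeakGradient φ G) (y : Eucl n) :
    MonotoneOn (gradEnergy G y) (Ioi 0) := by
  intro σ hσ ρ _ hσρ
  rcases hσρ.eq_or_lt with rfl | h
  · exact le_rfl
  have h1 := gradEnergy_sub_gradEnergy hN hmin hG y hσ h
  have h2 : 0 ≤ ∫ x in Metric.ball y ρ \ Metric.closedBall y σ,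
      ‖x - y‖ ^ (-(n : ℤ)) * ‖radialDeriv G y x‖ ^ 2 :=
    integral_nonneg fun x => by positivity
  linarith

lemma exists_tendsto_gradEnergy {N : Set (Eucl p)} (hN : IsCompact N)
    (hmin : IsEnergyMinimizing univ N φ) (hG : HasWeakGradient φ G) (y : Eucl n) :
    ∃ L, Tendsto (gradEnergy G y) (𝓝[>] 0) (𝓝 L) := by
  refine ⟨_, MonotoneOn.tendsto_nhdsWithin_Ioo_right (y := (1 : ℝ)) (by simp)
    ((gradEnergy_mono hN hmin hG y).mono fun x hx => hx.1) ⟨0, ?_⟩⟩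
  rintro _ ⟨ρ, hρ, rfl⟩
  exact gradEnergy_nonneg G y hρ.1

lemma tendsto_div_add_zpow (a : ℝ) (m : ℤ) :
    Tendsto (fun ρ : ℝ => (ρ / (ρ + a)) ^ m) atTop (𝓝 1) := by
  have h1 : Tendsto (fun ρ : ℝ => ρ / (ρ + a)) atTop (𝓝 1) := by
    have h2 : Tendsto (fun ρ : ℝ => 1 - a / (ρ + a)) atTop (𝓝 (1 - 0)) :=
      tendsto_const_nhds.sub (tendsto_const_nhds.div_atTop (tendsto_atTop_add_const_right _ a
        tendsto_id))
    rw [sub_zero] at h2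
    refine h2.congr' ?_
    filter_upwards [eventually_gt_atTop (-a)] with ρ hρ
    have : ρ + a ≠ 0 := by linarith
    field_simp
    ring
  have := h1.zpow₀ m (Or.inl one_ne_zero)
  simpa using this

lemma zpow_mul_energy_eq (G : Fin n → Eucl n → Eucl p) (y : Eucl n) {ρ r : ℝ} (hr : 0 < r) :
    ρ ^ (2 - (n : ℤ)) * ∫ x in Metric.ball y r, ∑ i, ‖G i x‖ ^ 2
      = (ρ / r) ^ (2 - (n : ℤ)) * gradEnergy G y r := by
  rw [gradEnergy, div_zpow, ← mul_assoc, div_mul_cancel₀ _ (zpow_ne_zero _ hr.ne')]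

/-- At infinity the scaled energies with different centers have the same limit. -/
lemma tendsto_gradEnergy_atTop (hG : HasWeakGradient φ G) {T : ℝ}
    (hT : ∀ c : ℝ, 0 < c → gradEnergy G 0 c = T) (y : Eucl n) :
    Tendsto (gradEnergy G y) atTop (𝓝 T) := by
  have hmono : ∀ {z w : Eucl n} {r s : ℝ}, Metric.ball z r ⊆ Metric.ball w s →
      ∫ x in Metric.ball z r, ∑ i, ‖G i x‖ ^ 2 ≤ ∫ x in Metric.ball w s, ∑ i, ‖G i x‖ ^ 2 :=
    -- Used for `B_{ρ-|y|}(0) ⊆ B_ρ(y) ⊆ B_{ρ+|y|}(0)`: the energy about `y` is squeezed between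
    -- multiples of `T` whose factors tend to `1`.
    fun {z w r s} h => setIntegral_mono_set (hG.integrableOn_sum_sq w s)
      (ae_of_all _ fun x => Finset.sum_nonneg fun i _ => by positivity) h.eventuallyLE
  refine tendsto_of_tendsto_of_tendsto_of_le_of_le'
    (g := fun ρ => (ρ / (ρ + -‖y‖)) ^ (2 - (n : ℤ)) * T)
    (h := fun ρ => (ρ / (ρ + ‖y‖)) ^ (2 - (n : ℤ)) * T) ?_ ?_ ?_ ?_
  · simpa using (tendsto_div_add_zpow (-‖y‖) (2 - (n : ℤ))).mul_const T
  · simpa using (tendsto_div_add_zpow ‖y‖ (2 - (n : ℤ))).mul_const T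
  · filter_upwards [eventually_gt_atTop ‖y‖] with ρ hρ
    have hρ0 : 0 < ρ := (norm_nonneg y).trans_lt hρ
    rw [← hT (ρ + -‖y‖) (by linarith), ← zpow_mul_energy_eq _ _ (by linarith)]
    refine mul_le_mul_of_nonneg_left (hmono (Metric.ball_subset_ball' ?_)) (by positivity)
    rw [dist_comm, dist_zero_right]
    linarith
  · filter_upwards [eventually_gt_atTop ‖y‖] with ρ hρ
    have hρ0 : 0 < ρ := (norm_nonneg y).trans_lt hρ
    have h2 : 0 < ρ + ‖y‖ := by linarith [norm_nonneg y]
    rw [← hT (ρ + ‖y‖) h2, ← zpow_mul_energy_eq _ _ h2]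
    refine mul_le_mul_of_nonneg_left (hmono (Metric.ball_subset_ball' ?_)) (by positivity)
    rw [dist_zero_right]

/-- Equality in the monotonicity formula kills the radial derivative on each annulus, and countably
many annuli exhaust the complement of `y`. -/
lemma radialDeriv_ae_eq_zero_of_const {N : Set (Eucl p)} (hN : IsCompact N)
    (hmin : IsEnergyMinimizing univ N φ) (hG : HasWeakGradient φ G) (y : Eucl n) {T : ℝ}
    (hT : ∀ c : ℝ, 0 < c → gradEnergy G y c = T) : ∀ᵐ x, radialDeriv G y x = 0 := by
  -- In dimension `0` the point `y` is not a null set.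
  rcases Nat.eq_zero_or_pos n with rfl | hn
  · exact ae_of_all _ fun x => by simp [radialDeriv]
  have : Nonempty (Fin n) := ⟨⟨0, hn⟩⟩
  have hann : ∀ k : ℕ, ∀ᵐ x : Eucl n,
      x ∈ Metric.ball y ((k : ℝ) + 2) \ Metric.closedBall y (1 / ((k : ℝ) + 2)) →
        radialDeriv G y x = 0 := by
    intro k
    have hk : (0 : ℝ) < (k : ℝ) + 2 := by positivity
    have hσ : 0 < 1 / ((k : ℝ) + 2) := by positivity
    have hlt : 1 / ((k : ℝ) + 2) < (k : ℝ) + 2 := by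
      rw [div_lt_iff₀ hk]
      nlinarith [(Nat.cast_nonneg k : (0 : ℝ) ≤ k)]
    have h := gradEnergy_sub_gradEnergy hN hmin hG y hσ hlt
    rw [hT _ hσ, hT _ hk, sub_self] at h
    have h0 := (mul_eq_zero.1 h.symm).resolve_left two_ne_zero
    have h1 := (setIntegral_eq_zero_iff_of_nonneg_ae (ae_of_all _ fun x => by
      simp only [Pi.zero_apply]; positivity) (hG.integrableOn_radial_weight y hσ)).1 h0
    have h2 := (ae_restrict_iff' (measurableSet_ball.diff measurableSet_closedBall)).1 h1
    filter_upwards [h2] with x hx hxm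
    have h3 := hx hxm
    have hne : ‖x - y‖ ≠ 0 := by
      have h4 := hxm.2
      rw [Metric.mem_closedBall, dist_eq_norm, not_le] at h4
      linarith
    simpa [zpow_eq_zero_iff, hne] using h3
  have hy : ∀ᵐ x : Eucl n, x ≠ y := by
    rw [ae_iff]
    simp
  filter_upwards [ae_all_iff.2 hann, hy] with x hx hxy
  have hpos : 0 < ‖x - y‖ := norm_pos_iff.2 (sub_ne_zero.2 hxy)
  obtain ⟨k, hk⟩ := exists_nat_gt (max ‖x - y‖ (1 / ‖x - y‖))
  refine hx k ⟨?_, ?_⟩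
  · rw [Metric.mem_ball, dist_eq_norm]
    linarith [le_max_left ‖x - y‖ (1 / ‖x - y‖)]
  · rw [Metric.mem_closedBall, dist_eq_norm, not_le, div_lt_iff₀ (by positivity)]
    have h1 := (le_max_right ‖x - y‖ (1 / ‖x - y‖)).trans_lt hk
    rw [div_lt_iff₀ hpos] at h1
    nlinarith

/-- The density at `y` attains its maximal value `T` exactly if `u` is homogeneous about `y`. -/
lemma tendsto_gradEnergy_iff {N : Set (Eucl p)} (hN : IsCompact N)
    (hmin : IsEnergyMinimizing univ N φ) (hG : HasWeakGradient φ G) {T : ℝ}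
    (hT : ∀ c : ℝ, 0 < c → gradEnergy G 0 c = T) (y : Eucl n) :
    Tendsto (gradEnergy G y) (𝓝[>] 0) (𝓝 T) ↔ ∀ᵐ x, radialDeriv G y x = 0 := by
  have hmono := gradEnergy_mono hN hmin hG y
  have htop := tendsto_gradEnergy_atTop hG hT y
  constructor
  · intro h
    -- A monotone function with limit `T` both at `0` and at infinity is constantly `T`.
    refine radialDeriv_ae_eq_zero_of_const hN hmin hG y (T := T) fun ρ hρ => ?_
    apply le_antisymm
    · refine ge_of_tendsto htop ?_
      filter_upwards [eventually_ge_atTop ρ] with r hr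
      exact hmono hρ (mem_Ioi.2 (hρ.trans_le hr)) hr
    · refine le_of_tendsto h ?_
      filter_upwards [Ioo_mem_nhdsGT hρ] with r hr
      exact hmono hr.1 hρ hr.2.le
  · intro h
    have hconst : ∀ σ ρ : ℝ, 0 < σ → σ < ρ → gradEnergy G y σ = gradEnergy G y ρ := by
      intro σ ρ hσ hσρ
      have h1 := gradEnergy_sub_gradEnergy hN hmin hG y hσ hσρ
      rw [integral_eq_zero_of_ae, mul_zero] at h1
      · linarith
      · filter_upwards [ae_restrict_of_ae h] with x hx
        simp [hx]
    have hT' : ∀ ρ : ℝ, 0 < ρ → gradEnergy G y ρ = T := by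
      intro ρ hρ
      refine tendsto_nhds_unique (tendsto_const_nhds.congr' ?_) htop
      filter_upwards [eventually_gt_atTop ρ] with r hr
      exact hconst ρ r hρ hr
    refine tendsto_const_nhds.congr' ?_
    filter_upwards [self_mem_nhdsWithin] with r hr
    exact (hT' r hr).symm

/-! ### Vanishing gradients and the invariant subspace. -/

open Convolution in
/-- A map whose weak gradient vanishes is constant almost everywhere. -/
lemma HasWeakGradient.exists_ae_eq_const (hG : HasWeakGradient u G) (hu : LocallyIntegrable u)
    (h0 : ∀ i, ∀ᵐ x, G i x = 0) : ∃ c, ∀ᵐ x, u x = c := by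
  let b : ℕ → ContDiffBump (0 : Eucl n) := fun k =>
    ⟨1 / ((k : ℝ) + 1), 2 / ((k : ℝ) + 1), by positivity, by gcongr; norm_num⟩
  have hconv : ∀ᵐ x₀, Tendsto
      (fun k => ((b k).normed volume ⋆[ContinuousLinearMap.lsmul ℝ ℝ, volume] u) x₀) atTop
      (𝓝 (u x₀)) := by
    refine ContDiffBump.ae_convolution_tendsto_right_of_locallyIntegrable (K := 2) ?_ ?_ hu
    · have := (tendsto_one_div_add_atTop_nhds_zero_nat (𝕜 := ℝ)).const_mul 2
      simpa [b, div_eq_mul_inv] using this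
    · exact Eventually.of_forall fun k => by simp [b, div_eq_mul_inv]
  -- Every mollification of `u` is constant: its derivative at `x` is the weak gradient of `u`
  -- tested against `t ↦ ψ(x - t)`. Since mollifications converge a.e. to `u`, one sequence of
  -- constants then has limit `u x₀` for a.e. `x₀`.
  have hzero : ∀ (ψ : Eucl n → ℝ), ContDiff ℝ ∞ ψ → HasCompactSupport ψ → ∀ x,
      (ψ ⋆[ContinuousLinearMap.lsmul ℝ ℝ, volume] u) x
        = (ψ ⋆[ContinuousLinearMap.lsmul ℝ ℝ, volume] u) 0 := by
    intro ψ hψ hψc x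
    have hd := fun x => hψc.hasFDerivAt_convolution_left (ContinuousLinearMap.lsmul ℝ ℝ)
      (hψ.of_le (by simp)) hu x
    refine is_const_of_fderiv_eq_zero (𝕜 := ℝ) (fun x => (hd x).differentiableAt) (fun x => ?_) x 0
    rw [(hd x).fderiv]
    have hex : ConvolutionExistsAt (fderiv ℝ ψ) u x
        ((ContinuousLinearMap.lsmul ℝ ℝ : ℝ →L[ℝ] Eucl p →L[ℝ] Eucl p).precompL (Eucl n)) volume :=
      (hψc.fderiv ℝ).convolutionExists_left _ (hψ.continuous_fderiv (by simp)) hu x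
    refine ContinuousLinearMap.ext fun w => ?_
    rw [zero_apply, ← ContinuousLinearMap.coe_coe, ← sum_coord_smul_map]
    refine Finset.sum_eq_zero fun i _ => ?_
    have hχ : ContDiff ℝ ∞ fun t : Eucl n => ψ (x - t) := hψ.comp (contDiff_const.sub contDiff_id)
    have hχc : HasCompactSupport fun t : Eucl n => ψ (x - t) :=
      hψc.comp_homeomorph (Homeomorph.subLeft x)
    have h1 := hG.integral_eq _ hχ hχc i
    have h2 : ∫ t, ψ (x - t) • G i t = 0 := by
      refine integral_eq_zero_of_ae ?_
      filter_upwards [h0 i] with t ht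
      simp [ht]
    have h3 : ∀ t, fderiv ℝ (fun t : Eucl n => ψ (x - t)) t (EuclideanSpace.single i 1)
        = - fderiv ℝ ψ (x - t) (EuclideanSpace.single i 1) := by
      intro t
      have hc := ((hψ.differentiable (by simp)).differentiableAt
        (x := x - t)).hasFDerivAt.comp t ((hasFDerivAt_id t).const_sub x)
      have : fderiv ℝ (fun t : Eucl n => ψ (x - t)) t = _ := hc.fderiv
      rw [this]
      simp
    simp only [h3, h2, neg_smul, integral_neg, neg_neg] at h1
    rw [ContinuousLinearMap.coe_coe, convolution_def, ContinuousLinearMap.integral_apply hex]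
    simp only [ContinuousLinearMap.precompL_apply, ContinuousLinearMap.lsmul_apply]
    rw [← integral_sub_left_eq_self _ volume x]
    simp only [sub_sub_cancel]
    rw [← h1, smul_zero]
  have hconv' : ∀ᵐ x₀, Tendsto
      (fun k => ((b k).normed volume ⋆[ContinuousLinearMap.lsmul ℝ ℝ, volume] u) 0) atTop
      (𝓝 (u x₀)) := by
    filter_upwards [hconv] with x₀ hx
    refine hx.congr fun k => ?_
    exact hzero _ (b k).contDiff_normed (b k).hasCompactSupport_normed x₀
  obtain ⟨x₁, hx₁⟩ := hconv'.exists
  exact ⟨u x₁, hconv'.mono fun x hx => tendsto_nhds_unique hx hx₁⟩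

lemma hasWeakGradient_const (c : Eucl p) :
    HasWeakGradient (fun _ : Eucl n => c) (fun _ _ => 0) where
  measurable := fun _ => measurable_const
  memLp := fun _ _ => MemLp.zero
  integral_eq := fun ψ h1 h2 i => by
    have h := integral_mul_fderiv_eq_neg_fderiv_mul_of_integrable (μ := volume)
      (f := fun _ : Eucl n => (1 : ℝ)) (g := ψ) (v := EuclideanSpace.single i 1) (by simp)
      (by
        simp only [one_mul]
        exact ((h1.continuous_fderiv (by simp)).clm_apply
          continuous_const).integrable_of_hasCompactSupport (h2.fderiv_apply (𝕜 := ℝ) _))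
      (by
        simp only [one_mul]
        exact h1.continuous.integrable_of_hasCompactSupport h2)
      (fun x _ => differentiableAt_const _)
      (fun x _ => (h1.differentiable (by simp)).differentiableAt)
    simp only [one_mul, fderiv_const_apply, zero_apply, zero_mul, integral_zero, neg_zero] at h
    rw [integral_smul_const (fun x => fderiv ℝ ψ x (EuclideanSpace.single i 1)), h]
    simp

/-- The vectors along which the weak directional derivative vanishes. -/
def invariantSubmodule (G : Fin n → Eucl n → Eucl p) : Submodule ℝ (Eucl n) where
  carrier := {y | ∀ᵐ x, ∑ i, y i • G i x = 0}
  zero_mem' := by simp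
  add_mem' := by
    intro a b ha hb
    change ∀ᵐ x, ∑ i, (a + b) i • G i x = 0
    filter_upwards [ha, hb] with x hxa hxb
    simp [add_smul, Finset.sum_add_distrib, hxa, hxb]
  smul_mem' := by
    intro c a ha
    change ∀ᵐ x, ∑ i, (c • a) i • G i x = 0
    filter_upwards [ha] with x hx
    simp [mul_smul, ← Finset.smul_sum, hx]

lemma mem_invariantSubmodule {y : Eucl n} :
    y ∈ invariantSubmodule G ↔ ∀ᵐ x, ∑ i, y i • G i x = 0 := Iff.rfl

/-- Since `(x - y)·Dφ = x·Dφ - y·Dφ` and homogeneity about `0` removes the first term, homogeneity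
about `y` becomes a linear condition on `y`. -/
lemma mem_invariantSubmodule_iff_radialDeriv (h0 : ∀ᵐ x, radialDeriv G 0 x = 0) (y : Eucl n) :
    y ∈ invariantSubmodule G ↔ ∀ᵐ x, radialDeriv G y x = 0 := by
  rw [mem_invariantSubmodule]
  have h : ∀ᵐ x, radialDeriv G y x = - ∑ i, y i • G i x := by
    filter_upwards [h0] with x hx
    simp only [radialDeriv, PiLp.sub_apply, sub_smul, Finset.sum_sub_distrib, sub_zero] at hx ⊢
    rw [hx, zero_sub]
  constructor <;> intro h'
  · filter_upwards [h, h'] with x hx hx'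
    rw [hx, hx', neg_zero]
  · filter_upwards [h, h'] with x hx hx'
    rw [hx'] at hx
    exact neg_eq_zero.1 hx.symm

lemma invariantSubmodule_eq_top_iff (hG : HasWeakGradient u G) (hu : LocallyIntegrable u) :
    invariantSubmodule G = ⊤ ↔ ∃ c, ∀ᵐ x, u x = c := by
  constructor
  · intro h
    refine hG.exists_ae_eq_const hu fun i => ?_
    have hi : EuclideanSpace.single i (1 : ℝ) ∈ invariantSubmodule G := h ▸ Submodule.mem_top
    filter_upwards [mem_invariantSubmodule.1 hi] with x hx
    simpa [Finset.sum_eq_single i] using hx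
  · rintro ⟨c, hc⟩
    refine eq_top_iff.2 fun y _ => ?_
    have h : ∀ i, ∀ᵐ x, G i x = 0 := fun i => hG.ae_eq (hasWeakGradient_const c) hc i
    rw [mem_invariantSubmodule]
    filter_upwards [ae_all_iff.2 h] with x hx
    simp [hx]

end homogeneous

end EnergyMin

end

/-- `N = range ι` is a compact smooth submanifold of `ℝᵖ` (with the induced metric). The limits
defining the density `Θ_φ` exist, `S(φ)` is a linear subspace of `ℝⁿ`, and
`dim S(φ) = n ↔ S(φ) = ℝⁿ ↔ φ` is (a.e.) constant. -/
theorem corollary2 {n p k : ℕ} (hn : 2 ≤ n)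
    {M : Type*} [TopologicalSpace M] [CompactSpace M]
    [ChartedSpace (EuclideanSpace ℝ (Fin k)) M] [IsManifold (𝓡 k) ∞ M]
    (ι : M → EuclideanSpace ℝ (Fin p)) (hι : Manifold.IsSmoothEmbedding (𝓡 k) (𝓡 p) ∞ ι)
    (φ : EuclideanSpace ℝ (Fin n) → EuclideanSpace ℝ (Fin p))
    (hφ : EnergyMin.IsHomogeneousMinimizer (range ι) φ) :
    (∀ y, Tendsto (EnergyMin.scaledEnergy φ y) (𝓝[>] 0) (𝓝 (EnergyMin.density φ y))) ∧
    ∃ V : Submodule ℝ (EuclideanSpace ℝ (Fin n)),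
      (V : Set (EuclideanSpace ℝ (Fin n))) = EnergyMin.maxDensitySet φ ∧
      (Module.finrank ℝ V = n ↔ EnergyMin.maxDensitySet φ = univ) ∧
      (EnergyMin.maxDensitySet φ = univ ↔
        ∃ c : EuclideanSpace ℝ (Fin p), ∀ᵐ x : EuclideanSpace ℝ (Fin n), φ x = c) := by
  have hN : IsCompact (range ι) := isCompact_range hι.isEmbedding.continuous
  obtain ⟨hmin, hhom⟩ := hφ
  obtain ⟨G, hG⟩ := EnergyMin.exists_hasWeakGradient hmin.1
  have hli := hmin.locallyIntegrable
  have hT : ∀ c : ℝ, 0 < c → EnergyMin.gradEnergy G 0 c = EnergyMin.gradEnergy G 0 1 :=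
    fun c hc => EnergyMin.gradEnergy_zero_eq hG hli hhom hc
  have hlim : ∀ y, Tendsto (EnergyMin.scaledEnergy φ y) (𝓝[>] 0)
      (𝓝 (EnergyMin.density φ y)) := fun y => by
    obtain ⟨L, hL⟩ := EnergyMin.exists_tendsto_gradEnergy hN hmin hG y
    rw [← hG.scaledEnergy_eq] at hL
    exact tendsto_nhds_limUnder ⟨L, hL⟩
  have hiff := EnergyMin.tendsto_gradEnergy_iff hN hmin hG hT
  have h0 : Tendsto (EnergyMin.gradEnergy G 0) (𝓝[>] 0) (𝓝 (EnergyMin.gradEnergy G 0 1)) := by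
    refine tendsto_const_nhds.congr' ?_
    filter_upwards [self_mem_nhdsWithin] with c hc
    exact (hT c hc).symm
  have hd0 : EnergyMin.density φ 0 = EnergyMin.gradEnergy G 0 1 := by
    have := hlim 0
    rw [hG.scaledEnergy_eq] at this
    exact tendsto_nhds_unique this h0
  -- Invariance along `y` is homogeneity about `y`, which is convergence of the scaled energy about
  -- `y` to `T`; as the limit exists and `T` is the density at `0`, this is equality of densities.
  have hV : (EnergyMin.invariantSubmodule G : Set (EuclideanSpace ℝ (Fin n)))
      = EnergyMin.maxDensitySet φ := by
    ext y
    rw [SetLike.mem_coe, EnergyMin.mem_invariantSubmodule_iff_radialDeriv ((hiff 0).1 h0), ← hiff,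
      EnergyMin.maxDensitySet, mem_ofPred_eq, hd0]
    have hy := hlim y
    rw [hG.scaledEnergy_eq] at hy
    exact ⟨fun h => tendsto_nhds_unique hy h, fun h => h ▸ hy⟩
  refine ⟨hlim, EnergyMin.invariantSubmodule G, hV, ?_, ?_⟩
  · rw [← hV, Submodule.coe_eq_univ]
    constructor
    · intro h
      exact Submodule.eq_top_of_finrank_eq (by rw [h, finrank_euclideanSpace_fin])
    · intro h
      rw [h, finrank_top, finrank_euclideanSpace_fin]
  · rw [← hV, Submodule.coe_eq_univ, EnergyMin.invariantSubmodule_eq_top_iff hG hli]
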